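/- Work over $\mathbb C$. For projective varieties $Y\subset\mathbb P^m$, $W\subset\mathbb P^n$ with affine cones $C(Y)\subset\mathbb C^{m+1}$, $C(W)\subset\mathbb C^{n+1}$ (the cone over the empty set being $\{0\}$), the join $Y\#W\subset\mathbb P^{m+n+1}$ is the image of $(C(Y)\times C(W))\setminus\{0\}$; $\mathbb P^n$ and its subsets are regarded as subsets of $\mathbb P^{m+n+1}$ through $[x]\mapsto[0:x]$. The Chow form of a $D$-dimensional irreducible subvariety $V\subset\mathbb P^N$ is the irreducible multihomogeneous form $F_V(\underline u^0,\dots,\underline u^D)$ in $D+1$ groups of $N+1$ variables, unique up to a nonzero constant, such that for all hyperplanes $\xi^0,\dots,\xi^D\subset\mathbb P^N$ with coefficient vectors $\underline\xi^0,\dots,\underline\xi^D$ one has $F_V(\underline\xi^0,\dots,\underline\xi^D)=0$ if and only if $\xi^0\cap\dots\cap\xi^D\cap V\neq\emptyset$. In $\mathbb P^{r+n+1}$ put ${}^t\underline u=(tu_0,\dots,tu_r,u_{r+1},\dots,u_{r+n+1})$ and ${}^tF_V(\underline u^0,\dots,\underline u^D)=F_V({}^t\underline u^0,\dots,{}^t\underline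 u^D)$ for $t\in\mathbb C\setminus\{0\}$. Theorem. Let $X\subset\mathbb P^n$ be an irreducible subvariety, let $r\ge 0$, and let $V$ be an irreducible subvariety of $\mathbb P^r\#X\subset\mathbb P^{r+n+1}$ of degree $d$ which meets $X$ properly in $\mathbb P^r\#X$, i.e. every irreducible component $C$ of $V\cap X$ satisfies $\dim C+\dim(\mathbb P^r\#X)=\dim V+\dim X$. Put $W=V\cap X$. Then $$V=\mathbb P^r\#W\quad\Longleftrightarrow\quad {}^tF_V=t^{(r+1)d}F_V\ \text{ for all } t\in\mathbb C\setminus\{0\}.$$ -/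

import Mathlib

noncomputable section

namespace ChowJoin

/-- The complex projective space with homogeneous coordinates indexed by `σ`;
`PSpace (Fin (n + 1))` is `ℙⁿ`. -/
abbrev PSpace (σ : Type) : Type := Projectivization ℂ (σ → ℂ)

/-- The affine cone over a subset of projective space: the preimage under the quotient map,
together with the origin. -/
def cone {σ : Type} (V : Set (PSpace σ)) : Set (σ → ℂ) :=
  {v | ∀ h : v ≠ 0, Projectivization.mk ℂ v h ∈ V}

/-- `V` is the common zero locus of a set of homogeneous polynomials. -/
def IsProjClosed {σ : Type} (V : Set (PSpace σ)) : Prop :=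
  ∃ S : Set (MvPolynomial σ ℂ), (∀ f ∈ S, ∃ e : ℕ, f.IsHomogeneous e) ∧
    ∀ p : PSpace σ, p ∈ V ↔ ∀ f ∈ S, MvPolynomial.eval p.rep f = 0

/-- Irreducible (closed, nonempty) subvarieties of projective space. -/
structure IsIrredVariety {σ : Type} (V : Set (PSpace σ)) : Prop where
  isClosed : IsProjClosed V
  nonempty : V.Nonempty
  irred : ∀ A B : Set (PSpace σ), IsProjClosed A → IsProjClosed B →
    V ⊆ A ∪ B → V ⊆ A ∨ V ⊆ B

/-- `C` is an irreducible component of `V`. -/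
def IsIrredComponent {σ : Type} (C V : Set (PSpace σ)) : Prop :=
  Maximal (fun Z : Set (PSpace σ) => IsIrredVariety Z ∧ Z ⊆ V) C

/-- The Krull dimension of the homogeneous coordinate ring of `V`, i.e. the dimension of the
affine cone over `V`. -/
def coneDim {σ : Type} (V : Set (PSpace σ)) : WithBot ℕ∞ :=
  ringKrullDim (MvPolynomial σ ℂ ⧸ MvPolynomial.vanishingIdeal ℂ (cone V))

/-- `V` has dimension `D`: its affine cone has dimension `D + 1`. -/
def HasDim {σ : Type} (V : Set (PSpace σ)) (D : ℕ) : Prop :=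
  coneDim V = (D : WithBot ℕ∞) + 1

/-- `V` and `X` meet properly in `Z`: every irreducible component `C` of `V ∩ X` satisfies
`dim C + dim Z = dim V + dim X`. The shift by one between the dimension of a variety and that of
its cone occurs twice on both sides. -/
def MeetsProperly {σ : Type} (V X Z : Set (PSpace σ)) : Prop :=
  ∀ C : Set (PSpace σ), IsIrredComponent C (V ∩ X) →
    coneDim C + coneDim Z = coneDim V + coneDim X

/-- The linear subspace of projective space defined by a vector subspace. -/
def linearSubspace {σ : Type} (L : Submodule ℂ (σ → ℂ)) : Set (PSpace σ) :=
  {p | p.rep ∈ L}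

/-- The degree of a variety `V`: the largest number of points in which `V` meets a linear subspace
of codimension `dim V`, among those linear subspaces which meet `V` in finitely many points. -/
def degree {σ : Type} [Fintype σ] (V : Set (PSpace σ)) : ℕ :=
  sSup {m : ℕ | ∃ L : Submodule ℂ (σ → ℂ),
    (Module.finrank ℂ L : WithBot ℕ∞) + coneDim V = (Fintype.card σ : WithBot ℕ∞) + 1 ∧
    (V ∩ linearSubspace L).Finite ∧ (V ∩ linearSubspace L).ncard = m}

/-- The join `Y # W`: the image in projective space of `C(Y) × C(W)` minus the origin. -/
def join {σ τ : Type} (Y : Set (PSpace σ)) (W : Set (PSpace τ)) : Set (PSpace (σ ⊕ τ)) :=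
  {p | ∃ y ∈ cone Y, ∃ w ∈ cone W, ∃ h : Sum.elim y w ≠ 0,
    p = Projectivization.mk ℂ (Sum.elim y w) h}

/-- The linear map `w ↦ (0, w)`. -/
def inrLinear (σ τ : Type) : (τ → ℂ) →ₗ[ℂ] (σ ⊕ τ → ℂ) where
  toFun w := Sum.elim 0 w
  map_add' v w := by ext (i | i) <;> simp
  map_smul' c w := by ext (i | i) <;> simp

theorem inrLinear_injective (σ τ : Type) : Function.Injective (inrLinear σ τ) := by
  intro v w h
  ext i
  exact congrFun h (Sum.inr i)

/-- The embedding `[x] ↦ [0 : x]` of the second factor into the ambient space of the join. -/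
def embR (σ τ : Type) : PSpace τ → PSpace (σ ⊕ τ) :=
  Projectivization.map (inrLinear σ τ) (inrLinear_injective σ τ)

/-- `F` is a Chow form of the `D`-dimensional variety `V`: an irreducible multihomogeneous form in
`D + 1` groups of variables `u⁰, …, u^D` whose zero set is the set of all tuples of hyperplanes
`ξ⁰, …, ξ^D` having a common point on `V`. The hyperplane with (not all zero) coefficients `a` is
`∑ j, a j * x j = 0`. -/
structure IsChowForm {σ : Type} [Fintype σ] (V : Set (PSpace σ)) {D : ℕ}
    (F : MvPolynomial (Fin (D + 1) × σ) ℂ) : Prop where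
  hasDim : HasDim V D
  irreducible : Irreducible F
  multihomogeneous : ∀ i : Fin (D + 1), ∃ e : ℕ,
    F.IsWeightedHomogeneous (fun q : Fin (D + 1) × σ => if q.1 = i then 1 else 0) e
  eval_eq_zero_iff : ∀ ξ : Fin (D + 1) → σ → ℂ, (∀ i, ξ i ≠ 0) →
    (MvPolynomial.eval (fun q => ξ q.1 q.2) F = 0 ↔
      ∃ p ∈ V, ∀ i, ∑ j, ξ i j * p.rep j = 0)

/-- `ᵗF`, i.e. `F(ᵗu⁰, …, ᵗu^D)` where `ᵗu` multiplies the first group of coordinates by `t`. -/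
def scaleForm {σ τ : Type} {D : ℕ} (t : ℂ) (F : MvPolynomial (Fin (D + 1) × (σ ⊕ τ)) ℂ) :
    MvPolynomial (Fin (D + 1) × (σ ⊕ τ)) ℂ :=
  MvPolynomial.bind₁ (fun q : Fin (D + 1) × (σ ⊕ τ) =>
    Sum.elim (fun _ => MvPolynomial.C t * MvPolynomial.X q) (fun _ => MvPolynomial.X q) q.2) F

end ChowJoin

end

noncomputable section

namespace ChowJoin

open MvPolynomial

/-! Write vectors of the ambient cone as `(x, y)` with `x` the `r + 1` coordinates of the vertex
`ℙ^r`, and let `t` act by `(t x, y)`. Scaling is self-adjoint (`dotProduct_scaleVec`), so rescaling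
the rows of `F` amounts to moving the points of `V`.

If `V = ℙ^r # W`, then `V` is invariant, so `F` divides all its rescalings by the Nullstellensatz
and `ᵗF = c F`. The constant is read off at a tuple with `F ≠ 0` in which `r + 1` rows involve only
`x` and the others only `y` (`IsChowForm.exists_split_rows`): each of the `r + 1` rows contributes
`t ^ d`, because `F` has degree `d` in each group (`IsChowForm.isWeightedHomogeneous`). For that
last fact, `F` is restricted to a line in one group of variables, which matches the points of a
linear section of `V` with roots of a polynomial.

Conversely, if every `ᵗF` is a nonzero multiple of `F`, then `V` is invariant, since a variety is
determined by its Chow form: a point off `V` lies on `D + 1` hyperplanes without common point on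
`V`. Letting `t` tend to `0` gives `(0, y)` in the cone for each `(x, y)` in it, so `V ⊆ ℙ^r # W`.
If `V` is not contained in `ℙ^r`, then `V ∩ X` is irreducible and properness makes the dimensions
agree, whence equality (`eq_join_of_meetsProperly`). If `V ⊆ ℙ^r`, then `W` is empty and properness
says nothing; here the exact exponent is needed. The scaling weight is `(D + 1) d`, so `D = r` and
`V = ℙ^r` (`IsChowForm.mem_cone_of_center`). -/

theorem eval_pow_weight_mul {ι : Type*} {w : ι → ℕ} {P : MvPolynomial ι ℂ} {e : ℕ}
    (hP : P.IsWeightedHomogeneous w e) (t : ℂ) (x : ι → ℂ) :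
    eval (fun q => t ^ w q * x q) P = t ^ e * eval x P := by
  simp only [eval_eq, Finset.mul_sum]
  refine Finset.sum_congr rfl fun m hm => ?_
  have he : ∑ q ∈ m.support, w q * m q = e := by
    have := hP (mem_support_iff.mp hm)
    rw [Finsupp.weight_apply, Finsupp.sum] at this
    simpa [mul_comm] using this
  rw [← he, ← Finset.prod_pow_eq_pow_sum, mul_left_comm, ← Finset.prod_mul_distrib]
  simp_rw [mul_pow, pow_mul]

theorem eval_smul_of_isHomogeneous {ι : Type*} {P : MvPolynomial ι ℂ} {e : ℕ}
    (hP : P.IsHomogeneous e) (t : ℂ) (x : ι → ℂ) : eval (t • x) P = t ^ e * eval x P := by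
  rw [← eval_pow_weight_mul hP t x]
  simp [Pi.smul_def]

/-! ### Forms in several groups of variables: restriction to lines and separability -/

section RowRestriction

variable {σ : Type} {D : ℕ}

/-- The value of a form in `D + 1` groups of variables at a tuple of coefficient vectors. -/
def rowEval (ξ : Fin (D + 1) → σ → ℂ) : MvPolynomial (Fin (D + 1) × σ) ℂ →+* ℂ :=
  eval fun q => ξ q.1 q.2

/-- The restriction of a form to the line `s ↦ v + s w` in the `i`-th group of variables, the other
groups being specialized to `ξ`. -/
def lineRestriction (ξ : Fin (D + 1) → σ → ℂ) (i : Fin (D + 1)) (v w : σ → ℂ)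
    (F : MvPolynomial (Fin (D + 1) × σ) ℂ) : Polynomial ℂ :=
  aeval (fun q : Fin (D + 1) × σ =>
    if q.1 = i then Polynomial.C (v q.2) + Polynomial.X * Polynomial.C (w q.2)
    else Polynomial.C (ξ q.1 q.2)) F

theorem eval_lineRestriction (ξ : Fin (D + 1) → σ → ℂ) (i : Fin (D + 1)) (v w : σ → ℂ)
    (F : MvPolynomial (Fin (D + 1) × σ) ℂ) (s : ℂ) :
    (lineRestriction ξ i v w F).eval s = rowEval (Function.update ξ i (v + s • w)) F := by
  induction F using MvPolynomial.induction_on with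
  | C a => simp [lineRestriction, rowEval]
  | add p q hp hq => simp only [lineRestriction, map_add, Polynomial.eval_add] at *; rw [hp, hq]
  | mul_X p q hp =>
    simp only [lineRestriction, map_mul, Polynomial.eval_mul] at *
    rw [hp]
    congr 1
    by_cases h : q.1 = i
    · simp [rowEval, h]
      exact mul_comm _ _
    · simp [rowEval, h]

/-- The `e`-th coefficient of a product of powers, with degree bounds. -/
theorem natDegree_coeff_prod {ι : Type*} (s : Finset ι) (f : ι → Polynomial ℂ) (a m : ι → ℕ)
    (c : ι → ℂ) (h : ∀ q ∈ s, (f q).natDegree ≤ a q ∧ (f q).coeff (a q) = c q) :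
    (∏ q ∈ s, f q ^ m q).natDegree ≤ ∑ q ∈ s, m q * a q ∧
      (∏ q ∈ s, f q ^ m q).coeff (∑ q ∈ s, m q * a q) = ∏ q ∈ s, c q ^ m q := by
  classical
  induction s using Finset.induction_on with
  | empty => simp
  | insert q s hq ih =>
    obtain ⟨h1, h2⟩ := ih fun x hx => h x (Finset.mem_insert_of_mem hx)
    obtain ⟨h3, h4⟩ := h q (Finset.mem_insert_self _ _)
    have h5 : (f q ^ m q).natDegree ≤ m q * a q := Polynomial.natDegree_pow_le_of_le _ h3
    rw [Finset.prod_insert hq, Finset.sum_insert hq, Finset.prod_insert hq]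
    refine ⟨Polynomial.natDegree_mul_le_of_le h5 h1, ?_⟩
    rw [Polynomial.coeff_mul_add_eq_of_natDegree_le h5 h1, h2, Polynomial.coeff_pow_of_natDegree_le h3,
      h4]

/-- Every monomial has exactly `e` factors from the `i`-th group, each becoming a polynomial of
degree at most one with top coefficient taken from `w`. So non-vanishing at `w` forces degree
exactly `e`, whatever the base point `v`. -/
theorem natDegree_coeff_lineRestriction (ξ : Fin (D + 1) → σ → ℂ) (i : Fin (D + 1)) (v w : σ → ℂ)
    {F : MvPolynomial (Fin (D + 1) × σ) ℂ} {e : ℕ}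
    (hF : F.IsWeightedHomogeneous (fun q : Fin (D + 1) × σ => if q.1 = i then 1 else 0) e) :
    (lineRestriction ξ i v w F).natDegree ≤ e ∧
      (lineRestriction ξ i v w F).coeff e = rowEval (Function.update ξ i w) F := by
  classical
  have key : ∀ m ∈ F.support,
      (∏ q ∈ m.support, (if q.1 = i then Polynomial.C (v q.2) + Polynomial.X * Polynomial.C (w q.2)
        else Polynomial.C (ξ q.1 q.2)) ^ m q).natDegree ≤ e ∧
      (∏ q ∈ m.support, (if q.1 = i then Polynomial.C (v q.2) + Polynomial.X * Polynomial.C (w q.2)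
        else Polynomial.C (ξ q.1 q.2)) ^ m q).coeff e =
        ∏ q ∈ m.support, Function.update ξ i w q.1 q.2 ^ m q := by
    intro m hm
    have he : ∑ q ∈ m.support, m q * (if q.1 = i then 1 else 0) = e := by
      have := hF (mem_support_iff.mp hm)
      rwa [Finsupp.weight_apply, Finsupp.sum] at this
    rw [← he]
    apply natDegree_coeff_prod
    intro q _
    by_cases h : q.1 = i
    · simp only [h, if_true, Function.update_self]
      constructor
      · compute_degree
      · simp
    · simp [h]
  have hsum : lineRestriction ξ i v w F = ∑ m ∈ F.support, Polynomial.C (coeff m F) *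
      ∏ q ∈ m.support, (if q.1 = i then Polynomial.C (v q.2) + Polynomial.X * Polynomial.C (w q.2)
        else Polynomial.C (ξ q.1 q.2)) ^ m q := by
    rw [lineRestriction, aeval_def, eval₂_eq]; rfl
  rw [hsum]
  constructor
  · apply Polynomial.natDegree_sum_le_of_forall_le
    intro m hm
    exact (Polynomial.natDegree_C_mul_le _ _).trans (key m hm).1
  · rw [Polynomial.finsetSum_coeff, rowEval, eval_eq]
    refine Finset.sum_congr rfl fun m hm => ?_
    rw [Polynomial.coeff_C_mul, (key m hm).2]

theorem rowEval_update_smul {F : MvPolynomial (Fin (D + 1) × σ) ℂ} {i : Fin (D + 1)} {e : ℕ}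
    (hF : F.IsWeightedHomogeneous (fun q : Fin (D + 1) × σ => if q.1 = i then 1 else 0) e)
    (ξ : Fin (D + 1) → σ → ℂ) (t : ℂ) :
    rowEval (Function.update ξ i (t • ξ i)) F = t ^ e * rowEval ξ F := by
  rw [rowEval, rowEval, ← eval_pow_weight_mul hF t]
  congr
  ext q
  by_cases h : q.1 = i
  · subst h
    simp
  · simp [h]

/-- A form of positive degree in a group of at least two variables has a nontrivial zero. -/
theorem exists_ne_zero_rowEval_update_eq_zero [Nontrivial σ]
    {F : MvPolynomial (Fin (D + 1) × σ) ℂ} {i : Fin (D + 1)} {e : ℕ} (he : e ≠ 0)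
    (hF : F.IsWeightedHomogeneous (fun q : Fin (D + 1) × σ => if q.1 = i then 1 else 0) e)
    (ξ : Fin (D + 1) → σ → ℂ) : ∃ u : σ → ℂ, u ≠ 0 ∧ rowEval (Function.update ξ i u) F = 0 := by
  classical
  obtain ⟨a, b, hab⟩ := exists_pair_ne σ
  by_cases hb : rowEval (Function.update ξ i (Pi.single b 1)) F = 0
  · exact ⟨Pi.single b 1, by simp, hb⟩
  obtain ⟨h1, h2⟩ := natDegree_coeff_lineRestriction ξ i (Pi.single a 1) (Pi.single b 1) hF
  have h3 : (lineRestriction ξ i (Pi.single a 1) (Pi.single b 1) F).natDegree = e :=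
    le_antisymm h1 (Polynomial.le_natDegree_of_ne_zero (h2 ▸ hb))
  obtain ⟨s, hs⟩ := IsAlgClosed.exists_root (lineRestriction ξ i (Pi.single a 1) (Pi.single b 1) F)
    (by
      intro h0
      rw [Polynomial.natDegree_eq_of_degree_eq_some h0] at h3
      exact he h3.symm)
  refine ⟨Pi.single a 1 + s • Pi.single b 1, ?_, ?_⟩
  · intro h
    have := congrFun h a
    simp [hab] at this
  · rw [← eval_lineRestriction]; exact hs

/-- Translation along `w` in the `i`-th group of variables, by a new variable. -/
def translate (i : Fin (D + 1)) (w : σ → ℂ) :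
    MvPolynomial (Fin (D + 1) × σ) ℂ →ₐ[ℂ] Polynomial (MvPolynomial (Fin (D + 1) × σ) ℂ) :=
  aeval fun q => Polynomial.C (X q) +
    if q.1 = i then Polynomial.X * Polynomial.C (C (w q.2)) else 0

/-- `translate` as an endomorphism of the polynomial ring in the new variable. -/
def translateEnd (i : Fin (D + 1)) (w : σ → ℂ) :
    Polynomial (MvPolynomial (Fin (D + 1) × σ) ℂ) →+*
      Polynomial (MvPolynomial (Fin (D + 1) × σ) ℂ) :=
  Polynomial.eval₂RingHom (translate i w).toRingHom Polynomial.X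

theorem translateEnd_comp (i : Fin (D + 1)) (w w' : σ → ℂ) (h : w + w' = 0) :
    (translateEnd i w').comp (translateEnd i w) = RingHom.id _ := by
  apply Polynomial.ringHom_ext'
  · apply MvPolynomial.ringHom_ext
    · intro a
      simp [translateEnd, translate]
    · intro q
      have h2 : w q.2 + w' q.2 = 0 := congrFun h q.2
      by_cases hq : q.1 = i
      · simp [translateEnd, translate, hq, add_assoc]
        rw [← add_mul, ← Polynomial.C_add, ← C_add, add_comm (w' _), h2]
        simp
      · simp [translateEnd, translate, hq]
  · simp [translateEnd]

/-- Translation by `w` is an automorphism of the polynomial ring, with inverse the translation by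
`-w`, and a prime stays prime when a variable is adjoined. -/
theorem irreducible_translate {F : MvPolynomial (Fin (D + 1) × σ) ℂ} (hF : Irreducible F)
    (i : Fin (D + 1)) (w : σ → ℂ) : Irreducible (translate i w F) := by
  let e : Polynomial (MvPolynomial (Fin (D + 1) × σ) ℂ) ≃+*
      Polynomial (MvPolynomial (Fin (D + 1) × σ) ℂ) :=
    RingEquiv.ofRingHom (translateEnd i w) (translateEnd i (-w))
      (translateEnd_comp i (-w) w (by simp)) (translateEnd_comp i w (-w) (by simp))
  have h1 : Irreducible (Polynomial.C F) := (Polynomial.prime_C_iff.mpr hF.prime).irreducible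
  have h2 : Irreducible (e (Polynomial.C F)) := (MulEquiv.irreducible_iff e).mpr h1
  have h3 : e (Polynomial.C F) = translate i w F := by
    change translateEnd i w (Polynomial.C F) = _
    simp [translateEnd]
  rwa [h3] at h2

/-- The translate is the universal restriction in the direction `w`: a generic condition on its
coefficients becomes a generic condition on `ξ`. -/
theorem map_translate (i : Fin (D + 1)) (w : σ → ℂ) (ξ : Fin (D + 1) → σ → ℂ)
    (F : MvPolynomial (Fin (D + 1) × σ) ℂ) :
    (translate i w F).map (rowEval ξ) = lineRestriction ξ i (ξ i) w F := by
  induction F using MvPolynomial.induction_on with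
  | C a =>
    have : translate i w (C a : MvPolynomial (Fin (D + 1) × σ) ℂ) = Polynomial.C (C a) := by
      simp [translate]
    rw [this]
    simp [lineRestriction, rowEval]
  | add p q hp hq => simp only [lineRestriction, map_add, Polynomial.map_add] at *; rw [hp, hq]
  | mul_X p q hp =>
    simp only [lineRestriction, map_mul, Polynomial.map_mul] at *
    rw [hp]
    congr 1
    by_cases h : q.1 = i
    · subst h
      simp [rowEval, translate]
    · simp [rowEval, translate, h]

/-- An irreducible polynomial of positive degree over a factorial domain of characteristic zero
remains separable under all specializations outside a hypersurface. -/
theorem exists_ne_zero_separable_map {R : Type*} [CommRing R] [IsDomain R]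
    [UniqueFactorizationMonoid R] [CharZero R] {f : Polynomial R} (hf : Irreducible f)
    (h0 : f.natDegree ≠ 0) : ∃ r : R, r ≠ 0 ∧
      ∀ φ : R →+* ℂ, φ r ≠ 0 → (f.map φ).Separable := by
  let K := FractionRing R
  have : CharZero K := charZero_of_injective_algebraMap (IsFractionRing.injective R K)
  have hinj := IsFractionRing.injective R K
  have hsep : (f.map (algebraMap R K)).Separable :=
    (((hf.isPrimitive h0).irreducible_iff_irreducible_map_fraction_map (K := K)).mp hf).separable
  -- It is nonzero because `f` stays irreducible, hence separable, over the fraction field. Its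
  -- Bézout identity holds over `R` and so specializes along `φ` even if the degree of `f` drops.
  refine ⟨f.resultant f.derivative, ?_, ?_⟩
  · intro h
    apply Polynomial.resultant_ne_zero _ _ hsep
    rw [Polynomial.derivative_map, Polynomial.natDegree_map_eq_of_injective hinj,
      Polynomial.natDegree_map_eq_of_injective hinj, Polynomial.resultant_map_map, h, map_zero]
  · intro φ hφ
    obtain ⟨p, q, -, -, h⟩ := Polynomial.exists_mul_add_mul_eq_C_resultant f f.derivative le_rfl
      le_rfl (Or.inl h0)
    have h' := congrArg (Polynomial.map φ) h
    simp only [Polynomial.map_add, Polynomial.map_mul, Polynomial.map_C] at h'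
    refine ⟨Polynomial.C (φ (f.resultant f.derivative))⁻¹ * p.map φ,
      Polynomial.C (φ (f.resultant f.derivative))⁻¹ * q.map φ, ?_⟩
    rw [Polynomial.derivative_map, mul_assoc, mul_assoc, ← mul_add, mul_comm (p.map φ),
      mul_comm (q.map φ), h', ← Polynomial.C_mul, inv_mul_cancel₀ hφ, Polynomial.C_1]

theorem exists_rowEval_ne_zero {F : MvPolynomial (Fin (D + 1) × σ) ℂ} (hF : F ≠ 0) :
    ∃ ξ : Fin (D + 1) → σ → ℂ, rowEval ξ F ≠ 0 := by
  by_contra! h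
  exact hF (MvPolynomial.funext fun x => by simpa [rowEval] using h fun i j => x (i, j))

/-- For generic `ξ`, the restriction of an irreducible form to a line in the direction `w` is
separable. -/
theorem exists_ne_zero_separable_lineRestriction {F : MvPolynomial (Fin (D + 1) × σ) ℂ}
    (hF : Irreducible F) {i : Fin (D + 1)} {e : ℕ} (he : e ≠ 0)
    (hh : F.IsWeightedHomogeneous (fun q : Fin (D + 1) × σ => if q.1 = i then 1 else 0) e)
    {ξ₀ : Fin (D + 1) → σ → ℂ} (h₀ : rowEval ξ₀ F ≠ 0) :
    ∃ r : MvPolynomial (Fin (D + 1) × σ) ℂ, r ≠ 0 ∧ ∀ ξ : Fin (D + 1) → σ → ℂ, rowEval ξ r ≠ 0 →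
      (lineRestriction ξ i (ξ i) (ξ₀ i) F).Separable := by
  obtain ⟨r, hr, h⟩ := exists_ne_zero_separable_map (irreducible_translate hF i (ξ₀ i)) (by
    intro h0
    have h1 := Polynomial.natDegree_map_le (f := rowEval ξ₀) (p := translate i (ξ₀ i) F)
    rw [map_translate, h0] at h1
    have h2 := (natDegree_coeff_lineRestriction ξ₀ i (ξ₀ i) (ξ₀ i) hh).2
    rw [Function.update_eq_self] at h2
    have h3 := Polynomial.le_natDegree_of_ne_zero (h2 ▸ h₀ :
      (lineRestriction ξ₀ i (ξ₀ i) (ξ₀ i) F).coeff e ≠ 0)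
    omega)
  exact ⟨r, hr, fun ξ hξ => map_translate i (ξ₀ i) ξ F ▸ h _ hξ⟩

end RowRestriction

/-! ### Cones, closed sets and dimension -/

section Cone

variable {σ : Type} {V W : Set (PSpace σ)}

theorem zero_mem_cone : (0 : σ → ℂ) ∈ cone V := fun h => absurd rfl h

theorem mk_mem_iff {v : σ → ℂ} (hv : v ≠ 0) : Projectivization.mk ℂ v hv ∈ V ↔ v ∈ cone V :=
  ⟨fun h _ => h, fun h => h hv⟩

theorem rep_mem_cone_iff {p : PSpace σ} : p.rep ∈ cone V ↔ p ∈ V := by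
  rw [← mk_mem_iff p.rep_nonzero, p.mk_rep]

theorem smul_mem_cone {v : σ → ℂ} (hv : v ∈ cone V) (c : ℂ) : c • v ∈ cone V := by
  intro h
  have hv0 : v ≠ 0 := fun h0 => h (by simp [h0])
  have : Projectivization.mk ℂ (c • v) h = Projectivization.mk ℂ v hv0 :=
    (Projectivization.mk_eq_mk_iff' ℂ _ _ _ _).mpr ⟨c, rfl⟩
  rw [this]
  exact hv hv0

theorem cone_subset_cone : cone V ⊆ cone W ↔ V ⊆ W :=
  ⟨fun h _ hp => rep_mem_cone_iff.mp (h (rep_mem_cone_iff.mpr hp)), fun h _ hv h0 => h (hv h0)⟩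

theorem cone_injective (h : cone V = cone W) : V = W :=
  (cone_subset_cone.mp h.le).antisymm (cone_subset_cone.mp h.ge)

theorem exists_rep_iff {P : (σ → ℂ) → Prop} (hP : ∀ (c : ℂ) v, P v → P (c • v)) :
    (∃ p ∈ V, P p.rep) ↔ ∃ v ∈ cone V, v ≠ 0 ∧ P v := by
  constructor
  · rintro ⟨p, hp, h⟩
    exact ⟨p.rep, rep_mem_cone_iff.mpr hp, p.rep_nonzero, h⟩
  · rintro ⟨v, hv, h0, h⟩
    refine ⟨Projectivization.mk ℂ v h0, hv h0, ?_⟩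
    obtain ⟨a, ha⟩ := Projectivization.exists_smul_eq_mk_rep ℂ v h0
    rw [← ha]
    exact hP _ _ h

/-- A closed set is defined by forms of positive degree; these define its cone. -/
theorem IsProjClosed.exists_cone (h : IsProjClosed V) :
    ∃ S : Set (MvPolynomial σ ℂ), (∀ f ∈ S, ∃ e : ℕ, f.IsHomogeneous (e + 1)) ∧
      ∀ v, v ∈ cone V ↔ ∀ f ∈ S, eval v f = 0 := by
  obtain ⟨S, hS, hV⟩ := h
  -- The factors `X j` change no projective zeros but make the origin a zero, even when `S` contains
  -- nonzero constants.
  refine ⟨{g | ∃ f ∈ S, ∃ j, g = f * X j}, ?_, ?_⟩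
  · rintro _ ⟨f, hf, j, rfl⟩
    obtain ⟨e, he⟩ := hS f hf
    exact ⟨e, he.mul (isHomogeneous_X _ _)⟩
  · intro v
    by_cases hv : v = 0
    · subst hv
      refine ⟨fun _ => ?_, fun _ => zero_mem_cone⟩
      rintro _ ⟨f, -, j, rfl⟩
      simp
    · rw [← mk_mem_iff hv, hV]
      obtain ⟨a, ha⟩ := Projectivization.exists_smul_eq_mk_rep ℂ v hv
      have key : ∀ f ∈ S, eval (Projectivization.mk ℂ v hv).rep f = 0 ↔ eval v f = 0 := by
        intro f hf
        obtain ⟨e, he⟩ := hS f hf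
        rw [← ha]
        have : eval (a • v) f = (a : ℂ) ^ e * eval v f := eval_smul_of_isHomogeneous he a v
        rw [this]
        simp
      constructor
      · rintro h _ ⟨f, hf, j, rfl⟩
        rw [map_mul, (key f hf).mp (h f hf), zero_mul]
      · intro h f hf
        rw [key f hf]
        obtain ⟨j, hj⟩ := Function.ne_iff.mp hv
        have := h _ ⟨f, hf, j, rfl⟩
        rw [map_mul, eval_X] at this
        exact (mul_eq_zero.mp this).resolve_right hj

theorem isProjClosed_of_cone (S : Set (MvPolynomial σ ℂ))
    (hS : ∀ f ∈ S, ∃ e : ℕ, f.IsHomogeneous e)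
    (h : ∀ v, v ≠ 0 → (v ∈ cone V ↔ ∀ f ∈ S, eval v f = 0)) : IsProjClosed V :=
  ⟨S, hS, fun p => by rw [← rep_mem_cone_iff, h _ p.rep_nonzero]⟩

end Cone

section Dimension

variable {σ : Type}

theorem coneDim_le [Fintype σ] (V : Set (PSpace σ)) : coneDim V ≤ (Fintype.card σ : ℕ) := by
  refine (ringKrullDim_quotient_le _).trans ?_
  rw [MvPolynomial.ringKrullDim_of_isNoetherianRing, ringKrullDim_eq_zero_of_field, zero_add,
    Nat.card_eq_fintype_card]

theorem HasDim.lt_card [Fintype σ] {V : Set (PSpace σ)} {D : ℕ} (h : HasDim V D) :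
    D + 1 ≤ Fintype.card σ := by
  have := coneDim_le V
  rw [h] at this
  exact_mod_cast this

end Dimension

/-! ### Linear sections have at most as many points as the degree of the Chow form -/

section ChowForm

variable {σ : Type} [Fintype σ] {V : Set (PSpace σ)} {D : ℕ}
  {F : MvPolynomial (Fin (D + 1) × σ) ℂ}

theorem IsChowForm.rowEval_eq_zero_iff_of_ne_zero (hF : IsChowForm V F)
    {ξ : Fin (D + 1) → σ → ℂ} (hξ : ∀ i, ξ i ≠ 0) :
    rowEval ξ F = 0 ↔ ∃ v ∈ cone V, v ≠ 0 ∧ ∀ i, ξ i ⬝ᵥ v = 0 := by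
  rw [← exists_rep_iff (P := fun v => ∀ i, ξ i ⬝ᵥ v = 0)]
  · exact hF.eval_eq_zero_iff ξ hξ
  · intro c v h i
    rw [dotProduct_smul, h i, smul_zero]

theorem dual_apply_eq_dotProduct [DecidableEq σ] (f : Module.Dual ℂ (σ → ℂ)) (v : σ → ℂ) :
    f v = (fun j => f (Pi.single j 1)) ⬝ᵥ v := by
  rw [LinearMap.pi_apply_eq_sum_univ f v, dotProduct]
  refine Finset.sum_congr rfl fun j _ => ?_
  rw [smul_eq_mul, mul_comm]
  congr 2
  ext k
  simp [Pi.single_apply, eq_comm]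

theorem exists_dotProduct_ne_zero {ι : Type*} [Finite ι] (a : ι → σ → ℂ) (ha : ∀ i, a i ≠ 0) :
    ∃ v : σ → ℂ, ∀ i, a i ⬝ᵥ v ≠ 0 := by
  classical
  obtain ⟨f, hf⟩ := Module.exists_dual_forall_apply_ne_zero (K := ℂ) a ha
  refine ⟨fun j => f (Pi.single j 1), fun i => ?_⟩
  rw [dotProduct_comm, ← dual_apply_eq_dotProduct]
  exact hf i

theorem exists_ne_zero_dotProduct_eq_zero [Nontrivial σ] (w : σ → ℂ) :
    ∃ a : σ → ℂ, a ≠ 0 ∧ a ⬝ᵥ w = 0 := by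
  classical
  obtain ⟨i, j, hij⟩ := exists_pair_ne σ
  by_cases h : w i = 0
  · exact ⟨Pi.single i 1, by simp, by simp [h]⟩
  · refine ⟨w j • Pi.single i 1 - w i • Pi.single j 1, fun h0 => h ?_, ?_⟩
    · have := congrFun h0 j
      simpa [hij.symm] using this
    · simp [sub_dotProduct, mul_comm]

/-- A linear section of `V` of complementary dimension on which the Chow form does not vanish
identically has at most as many points as the degree of the Chow form. -/
theorem IsChowForm.card_le [Nontrivial σ] (hF : IsChowForm V F) {i : Fin (D + 1)} {e : ℕ}
    (hh : F.IsWeightedHomogeneous (fun q : Fin (D + 1) × σ => if q.1 = i then 1 else 0) e)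
    {ξ : Fin (D + 1) → σ → ℂ} (hξ : ∀ k, k ≠ i → ξ k ≠ 0) {w : σ → ℂ} (hw : w ≠ 0)
    (hFw : rowEval (Function.update ξ i w) F ≠ 0) (T : Finset (PSpace σ))
    (hT : ∀ p ∈ T, p ∈ V ∧ ∀ k, k ≠ i → ξ k ⬝ᵥ p.rep = 0) : T.card ≤ e := by
  classical
  have hmeet : ∀ u : σ → ℂ, u ≠ 0 → ∀ p ∈ T, u ⬝ᵥ p.rep = 0 →
      rowEval (Function.update ξ i u) F = 0 := by
    intro u hu p hp h
    rw [hF.rowEval_eq_zero_iff_of_ne_zero]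
    · refine ⟨p.rep, rep_mem_cone_iff.mpr (hT p hp).1, p.rep_nonzero, fun k => ?_⟩
      by_cases hk : k = i
      · subst hk; simpa using h
      · simpa [hk] using (hT p hp).2 k hk
    · intro k
      by_cases hk : k = i
      · subst hk; simpa using hu
      · simpa [hk] using hξ k hk
  have hwp : ∀ p ∈ T, w ⬝ᵥ p.rep ≠ 0 := fun p hp h => hFw (hmeet w hw p hp h)
  -- The defining property of `F` concerns nonzero rows only. As `a` is orthogonal to `w`, choosing
  -- `v` with `a ⬝ᵥ v ≠ 0` keeps the whole line `v + s • w` off the origin.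
  obtain ⟨a, ha, haw⟩ := exists_ne_zero_dotProduct_eq_zero w
  obtain ⟨v, hv⟩ := exists_dotProduct_ne_zero
    (fun x : {x : Option (T × T) // ∀ y, x = some y → y.1 ≠ y.2} =>
      match x with
      | ⟨none, _⟩ => a
      | ⟨some (p, q), _⟩ => (w ⬝ᵥ q.1.rep) • p.1.rep - (w ⬝ᵥ p.1.rep) • q.1.rep) (by
    rintro ⟨_ | ⟨p, q⟩, h⟩
    · exact ha
    · have hpq := h _ rfl
      intro h0
      apply hpq
      apply Subtype.ext
      rw [← p.1.mk_rep, ← q.1.mk_rep, Projectivization.mk_eq_mk_iff']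
      refine ⟨(w ⬝ᵥ p.1.rep) / (w ⬝ᵥ q.1.rep), ?_⟩
      rw [div_eq_inv_mul, mul_smul, ← sub_eq_zero.mp h0, smul_smul,
        inv_mul_cancel₀ (hwp _ q.2), one_smul])
  have hav : a ⬝ᵥ v ≠ 0 := hv ⟨none, by simp⟩
  have hvs : ∀ s : ℂ, v + s • w ≠ 0 := by
    intro s h0
    apply hav
    have := congrArg (a ⬝ᵥ ·) h0
    simpa [dotProduct_add, haw] using this
  have hpq : ∀ p ∈ T, ∀ q ∈ T, p ≠ q →
      (w ⬝ᵥ q.rep) * (p.rep ⬝ᵥ v) - (w ⬝ᵥ p.rep) * (q.rep ⬝ᵥ v) ≠ 0 := by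
    intro p hp q hq h
    have := hv ⟨some (⟨p, hp⟩, ⟨q, hq⟩), by
      rintro y hy
      cases hy
      simpa using h⟩
    simpa [sub_dotProduct] using this
  obtain ⟨h1, h2⟩ := natDegree_coeff_lineRestriction ξ i v w hh
  set h := lineRestriction ξ i v w F with hdef
  have h0 : h ≠ 0 := fun h0 => hFw (by rw [← h2, h0, Polynomial.coeff_zero])
  calc T.card ≤ h.roots.toFinset.card := by
        -- This is the one `s` for which the hyperplane `v + s • w` passes through `p`; `v` was
        -- chosen so that distinct points give distinct values.
        refine Finset.card_le_card_of_injOn (fun p => -(p.rep ⬝ᵥ v) / (w ⬝ᵥ p.rep)) ?_ ?_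
        · intro p hp
          rw [Finset.mem_coe, Multiset.mem_toFinset, Polynomial.mem_roots h0,
            Polynomial.IsRoot.def, hdef, eval_lineRestriction]
          refine hmeet _ (hvs _) p hp ?_
          rw [add_dotProduct, smul_dotProduct, smul_eq_mul, div_mul_cancel₀ _ (hwp p hp),
            dotProduct_comm v, add_neg_cancel]
        · intro p hp q hq hs
          by_contra hne
          apply hpq p hp q hq hne
          have := (div_eq_div_iff (hwp p hp) (hwp q hq)).mp hs
          linear_combination -this
    _ ≤ h.roots.card := Multiset.toFinset_card_le _
    _ ≤ e := (Polynomial.card_roots' h).trans h1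

/-- A set of `D` hyperplanes always meets a variety of dimension `D`. -/
theorem IsChowForm.exists_mem_cone [Nontrivial σ] (hF : IsChowForm V F) {i : Fin (D + 1)} {e : ℕ}
    (he : e ≠ 0)
    (hh : F.IsWeightedHomogeneous (fun q : Fin (D + 1) × σ => if q.1 = i then 1 else 0) e)
    (ξ : Fin (D + 1) → σ → ℂ) : ∃ v ∈ cone V, v ≠ 0 ∧ ∀ k, k ≠ i → ξ k ⬝ᵥ v = 0 := by
  classical
  let ξ' : Fin (D + 1) → σ → ℂ := fun k => if ξ k = 0 then 1 else ξ k
  have hξ' : ∀ k, ξ' k ≠ 0 := by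
    intro k
    by_cases h : ξ k = 0 <;> simp [ξ', h]
  obtain ⟨u, hu, h⟩ := exists_ne_zero_rowEval_update_eq_zero he hh ξ'
  rw [hF.rowEval_eq_zero_iff_of_ne_zero] at h
  · obtain ⟨v, hv, hv0, h⟩ := h
    refine ⟨v, hv, hv0, fun k hk => ?_⟩
    by_cases h0 : ξ k = 0
    · simp [h0]
    · simpa [hk, ξ', h0] using h k
  · intro k
    by_cases hk : k = i
    · subst hk; simpa using hu
    · simpa [hk] using hξ' k

/-- A basis of the annihilator of `L` supplies the `D` fixed rows, and a finite section is missed by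
some hyperplane `w`, so `IsChowForm.card_le` applies. -/
theorem IsChowForm.degree_le [Nontrivial σ] (hF : IsChowForm V F) {i : Fin (D + 1)} {e : ℕ}
    (hh : F.IsWeightedHomogeneous (fun q : Fin (D + 1) × σ => if q.1 = i then 1 else 0) e)
    {L : Submodule ℂ (σ → ℂ)}
    (hL : (Module.finrank ℂ L : WithBot ℕ∞) + coneDim V = (Fintype.card σ : WithBot ℕ∞) + 1)
    (hfin : (V ∩ linearSubspace L).Finite) : (V ∩ linearSubspace L).ncard ≤ e := by
  classical
  have hL' : Module.finrank ℂ L + D = Fintype.card σ := by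
    rw [hF.hasDim] at hL
    have : Module.finrank ℂ L + (D + 1) = Fintype.card σ + 1 := by exact_mod_cast hL
    omega
  have hD : Module.finrank ℂ L.dualAnnihilator = D := by
    have := Subspace.finrank_add_finrank_dualAnnihilator_eq L
    rw [Module.finrank_fintype_fun_eq_card] at this
    omega
  let b := Module.finBasisOfFinrankEq ℂ L.dualAnnihilator hD
  let c := b.reindex (finSuccAboveEquiv i)
  let ξ : Fin (D + 1) → σ → ℂ := fun k =>
    if hk : k ≠ i then fun j => (c ⟨k, hk⟩ : Module.Dual ℂ (σ → ℂ)) (Pi.single j 1) else 0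
  have hdot : ∀ k (hk : k ≠ i) v, ξ k ⬝ᵥ v = (c ⟨k, hk⟩ : Module.Dual ℂ (σ → ℂ)) v := by
    intro k hk v
    rw [dual_apply_eq_dotProduct]
    simp [ξ, hk]
  have hξ : ∀ k, k ≠ i → ξ k ≠ 0 := by
    intro k hk h0
    apply c.ne_zero ⟨k, hk⟩
    apply Subtype.ext
    refine LinearMap.ext fun v => ?_
    rw [← hdot k hk, h0, zero_dotProduct]
    rfl
  have hmem : ∀ v, v ∈ L ↔ ∀ k, k ≠ i → ξ k ⬝ᵥ v = 0 := by
    intro v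
    rw [← Subspace.forall_mem_dualAnnihilator_apply_eq_zero_iff L v]
    constructor
    · intro h k hk
      rw [hdot k hk]
      exact h _ (c _).2
    · intro h φ hφ
      have h1 : L.dualAnnihilator.subtype ⟨φ, hφ⟩ = φ := rfl
      rw [← h1, ← c.sum_repr ⟨φ, hφ⟩]
      simp only [map_sum, map_smul, LinearMap.sum_apply, LinearMap.smul_apply]
      refine Finset.sum_eq_zero fun k _ => ?_
      have := h k.1 k.2
      rw [hdot k.1 k.2] at this
      simp [this]
  have : Finite (V ∩ linearSubspace L : Set (PSpace σ)) := hfin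
  -- The extra index `none`, carrying the vector `1`, ensures `w ≠ 0` even if the section is empty.
  obtain ⟨w, hw⟩ := exists_dotProduct_ne_zero
    (fun x : Option (V ∩ linearSubspace L : Set (PSpace σ)) => x.elim 1 fun p => p.1.rep) (by
      rintro (_ | p)
      · exact one_ne_zero
      · exact p.1.rep_nonzero)
  have hw0 : w ≠ 0 := by
    rintro rfl
    exact hw none (by simp)
  rw [Set.ncard_eq_toFinset_card _ hfin]
  refine hF.card_le hh hξ hw0 ?_ _ ?_
  · rw [Ne, hF.rowEval_eq_zero_iff_of_ne_zero,
      ← exists_rep_iff (P := fun v => ∀ k, Function.update ξ i w k ⬝ᵥ v = 0)]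
    · rintro ⟨p, hp, h⟩
      have h1 : p.rep ∈ L := by
        rw [hmem]
        intro k hk
        simpa [hk] using h k
      apply hw (some ⟨p, hp, h1⟩)
      have := h i
      rw [Function.update_self] at this
      rw [dotProduct_comm]
      exact this
    · intro c v h k
      rw [dotProduct_smul, h k, smul_zero]
    · intro k
      by_cases hk : k = i
      · subst hk; simpa using hw0
      · simpa [hk] using hξ k hk
  · intro p hp
    rw [Set.Finite.mem_toFinset] at hp
    exact ⟨hp.1, (hmem _).mp hp.2⟩

end ChowForm

/-! ### The degree of the variety is attained by the Chow form -/

section ChowDegree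

variable {σ : Type} [Fintype σ] {V : Set (PSpace σ)} {D : ℕ}
  {F : MvPolynomial (Fin (D + 1) × σ) ℂ}

/-- For a suitable linear section the number of points is at least the degree of the Chow form. -/
theorem IsChowForm.exists_le_ncard [Nontrivial σ] (hF : IsChowForm V F) {i : Fin (D + 1)} {e : ℕ}
    (he : e ≠ 0)
    (hh : F.IsWeightedHomogeneous (fun q : Fin (D + 1) × σ => if q.1 = i then 1 else 0) e) :
    ∃ L : Submodule ℂ (σ → ℂ),
      (Module.finrank ℂ L : WithBot ℕ∞) + coneDim V = (Fintype.card σ : WithBot ℕ∞) + 1 ∧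
      (V ∩ linearSubspace L).Finite ∧ e ≤ (V ∩ linearSubspace L).ncard := by
  classical
  obtain ⟨ξ₀, h₀⟩ := exists_rowEval_ne_zero hF.irreducible.ne_zero
  set w := ξ₀ i with hw
  obtain ⟨r, hr, hsep⟩ := exists_ne_zero_separable_lineRestriction hF.irreducible he hh h₀
  -- the condition that the Chow form does not vanish at `w`
  let Q : MvPolynomial (Fin (D + 1) × σ) ℂ :=
    bind₁ (fun q => if q.1 = i then C (w q.2) else X q) F
  have hQ : ∀ ξ : Fin (D + 1) → σ → ℂ, rowEval ξ Q = rowEval (Function.update ξ i w) F := by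
    intro ξ
    simp only [rowEval, Q, eval, eval₂Hom_bind₁]
    congr 2
    ext q
    by_cases h : q.1 = i <;> simp [h]
  have hQ0 : Q ≠ 0 := by
    intro h
    apply h₀
    have := hQ ξ₀
    rw [h, map_zero, hw, Function.update_eq_self] at this
    exact this.symm
  -- the condition that the hyperplanes are independent
  have hcard : Fintype.card {k : Fin (D + 1) // k ≠ i} = D := by
    simp [Fintype.card_subtype_compl]
  obtain ⟨ι⟩ : Nonempty ({k : Fin (D + 1) // k ≠ i} ↪ σ) := by
    apply Function.Embedding.nonempty_of_card_le
    have := hF.hasDim.lt_card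
    omega
  let δ : MvPolynomial (Fin (D + 1) × σ) ℂ :=
    Matrix.det (Matrix.of fun a b : {k : Fin (D + 1) // k ≠ i} => X (a.1, ι b))
  have hδ : ∀ ξ : Fin (D + 1) → σ → ℂ, rowEval ξ δ =
      Matrix.det (Matrix.of fun a b : {k : Fin (D + 1) // k ≠ i} => ξ a.1 (ι b)) := by
    intro ξ
    simp only [δ, RingHom.map_det]
    congr 1
    ext a b
    simp [rowEval]
  have hδ0 : δ ≠ 0 := by
    intro h
    have := hδ fun k j => if hk : k ≠ i then (if j = ι ⟨k, hk⟩ then 1 else 0) else 0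
    rw [h, map_zero] at this
    have h1 : (Matrix.of fun a b : {k : Fin (D + 1) // k ≠ i} =>
        (if hk : a.1 ≠ i then (if ι b = ι ⟨a.1, hk⟩ then (1 : ℂ) else 0) else 0)) = 1 := by
      ext a b
      rw [Matrix.of_apply, dif_pos a.2, Matrix.one_apply]
      simp [eq_comm]
    rw [h1, Matrix.det_one] at this
    exact zero_ne_one this
  obtain ⟨ξ, hξ⟩ := exists_rowEval_ne_zero (mul_ne_zero (mul_ne_zero hr hQ0) hδ0)
  rw [map_mul, map_mul, hQ, hδ] at hξ
  have hξr := left_ne_zero_of_mul (left_ne_zero_of_mul hξ)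
  have hξQ := right_ne_zero_of_mul (left_ne_zero_of_mul hξ)
  have hξδ := right_ne_zero_of_mul hξ
  let M : Matrix {k : Fin (D + 1) // k ≠ i} σ ℂ := Matrix.of fun a j => ξ a.1 j
  have hM : LinearIndependent ℂ M.row := by
    have := Matrix.linearIndependent_rows_of_det_ne_zero hξδ
    exact LinearIndependent.of_comp (LinearMap.funLeft ℂ ℂ ι) this
  have hξ0 : ∀ k, k ≠ i → ξ k ≠ 0 := fun k hk => hM.ne_zero (⟨k, hk⟩ : {k : Fin (D + 1) // k ≠ i})
  let L := LinearMap.ker M.mulVecLin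
  have hmem : ∀ v, v ∈ L ↔ ∀ k, k ≠ i → ξ k ⬝ᵥ v = 0 := by
    intro v
    rw [LinearMap.mem_ker, Matrix.mulVecLin_apply, _root_.funext_iff]
    exact ⟨fun h k hk => h ⟨k, hk⟩, fun h k => h k.1 k.2⟩
  have hw0 : w ≠ 0 := by
    intro h
    apply h₀
    have := rowEval_update_smul hh ξ₀ 0
    rw [zero_smul, ← h, hw, Function.update_eq_self, zero_pow he, zero_mul] at this
    exact this
  have hfin : (V ∩ linearSubspace L).Finite := by
    by_contra hinf
    obtain ⟨T, hT, hTc⟩ := Set.Infinite.exists_subset_card_eq hinf (e + 1)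
    have := hF.card_le hh hξ0 hw0 hξQ T fun p hp => ⟨(hT hp).1, (hmem _).mp (hT hp).2⟩
    omega
  have hrank : Module.finrank ℂ L + D = Fintype.card σ := by
    have h1 := LinearMap.finrank_range_add_finrank_ker M.mulVecLin
    have h2 : Module.finrank ℂ (LinearMap.range M.mulVecLin) = D :=
      hM.rank_matrix.trans hcard
    rw [Module.finrank_fintype_fun_eq_card] at h1
    change Module.finrank ℂ (LinearMap.ker M.mulVecLin) + D = _
    omega
  refine ⟨L, ?_, hfin, ?_⟩
  · rw [hF.hasDim, ← hrank]
    push_cast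
    rw [add_assoc]
  obtain ⟨hdeg, hcoeff⟩ := natDegree_coeff_lineRestriction ξ i (ξ i) w hh
  have hs := hsep ξ hξr
  -- Separability gives `e` distinct roots. Each yields a point of the section on the hyperplane `ξ
  -- i + s • w`, and no point serves two roots because `w` misses the section.
  set h := lineRestriction ξ i (ξ i) w F with hdef
  have hdeg' : h.natDegree = e :=
    le_antisymm hdeg (Polynomial.le_natDegree_of_ne_zero (hcoeff ▸ hξQ))
  have hwp : ∀ p ∈ V ∩ linearSubspace L, w ⬝ᵥ p.rep ≠ 0 := by
    intro p hp h0
    apply hξQ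
    rw [hF.rowEval_eq_zero_iff_of_ne_zero]
    · refine ⟨p.rep, rep_mem_cone_iff.mpr hp.1, p.rep_nonzero, fun k => ?_⟩
      by_cases hk : k = i
      · subst hk; simpa using h0
      · simpa [hk] using (hmem _).mp hp.2 k hk
    · intro k
      by_cases hk : k = i
      · subst hk; simpa using hw0
      · simpa [hk] using hξ0 k hk
  have hroot : ∀ s : h.rootSet ℂ, ∃ p ∈ V ∩ linearSubspace L, (ξ i + s.1 • w) ⬝ᵥ p.rep = 0 := by
    intro s
    have h1 : rowEval (Function.update ξ i (ξ i + s.1 • w)) F = 0 := by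
      rw [← eval_lineRestriction]
      have := Polynomial.aeval_eq_zero_of_mem_rootSet s.2
      simpa using this
    have h2 : ∃ v ∈ cone V, v ≠ 0 ∧
        (v ∈ L ∧ (ξ i + s.1 • w) ⬝ᵥ v = 0) := by
      -- At the zero row the last condition is empty, so any point of the section will do.
      by_cases hu : ξ i + s.1 • w = 0
      · obtain ⟨v, hv, hv0, h3⟩ := hF.exists_mem_cone he hh ξ
        exact ⟨v, hv, hv0, (hmem v).mpr h3, by rw [hu, zero_dotProduct]⟩
      · rw [hF.rowEval_eq_zero_iff_of_ne_zero] at h1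
        · obtain ⟨v, hv, hv0, h3⟩ := h1
          refine ⟨v, hv, hv0, (hmem v).mpr fun k hk => ?_, ?_⟩
          · simpa [hk] using h3 k
          · simpa using h3 i
        · intro k
          by_cases hk : k = i
          · subst hk; simpa using hu
          · simpa [hk] using hξ0 k hk
    rw [← exists_rep_iff (P := fun v => v ∈ L ∧ (ξ i + s.1 • w) ⬝ᵥ v = 0)] at h2
    · obtain ⟨p, hp, h3, h4⟩ := h2
      exact ⟨p, ⟨hp, h3⟩, h4⟩
    · rintro c v ⟨h3, h4⟩
      exact ⟨L.smul_mem c h3, by rw [dotProduct_smul, h4, smul_zero]⟩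
  choose f hfV hf using hroot
  have hinj : Function.Injective f := by
    intro s t hst
    have h1 := hf s
    have h2 := hf t
    rw [← hst] at h2
    rw [add_dotProduct, smul_dotProduct, smul_eq_mul] at h1 h2
    have h3 : s.1 * (w ⬝ᵥ (f s).rep) = t.1 * (w ⬝ᵥ (f s).rep) := by linear_combination h1 - h2
    exact Subtype.ext (mul_right_cancel₀ (hwp _ (hfV s)) h3)
  rw [← hdeg', ← Polynomial.card_rootSet_eq_natDegree (K := ℂ) hs (IsAlgClosed.splits _),
    ← Nat.card_eq_fintype_card, ← Nat.card_coe_set_eq]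
  have : Finite (V ∩ linearSubspace L : Set (PSpace σ)) := hfin
  exact Nat.card_le_card_of_injective (fun s => (⟨f s, hfV s⟩ : (V ∩ linearSubspace L :
    Set (PSpace σ)))) fun s t hst => hinj (congrArg Subtype.val hst)

/-- The Chow form has degree `deg V` in each group of variables. -/
theorem IsChowForm.isWeightedHomogeneous [Nontrivial σ] (hF : IsChowForm V F) (i : Fin (D + 1)) :
    F.IsWeightedHomogeneous (fun q : Fin (D + 1) × σ => if q.1 = i then 1 else 0) (degree V) := by
  obtain ⟨e, hh⟩ := hF.multihomogeneous i
  suffices degree V = e from this ▸ hh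
  have hle : ∀ m ∈ {m : ℕ | ∃ L : Submodule ℂ (σ → ℂ),
      (Module.finrank ℂ L : WithBot ℕ∞) + coneDim V = (Fintype.card σ : WithBot ℕ∞) + 1 ∧
      (V ∩ linearSubspace L).Finite ∧ (V ∩ linearSubspace L).ncard = m}, m ≤ e := by
    rintro _ ⟨L, hL, hfin, rfl⟩
    exact hF.degree_le hh hL hfin
  apply le_antisymm
  · exact csSup_le' hle
  · by_cases he : e = 0
    · omega
    · obtain ⟨L, hL, hfin, h⟩ := hF.exists_le_ncard he hh
      exact h.trans (le_csSup ⟨e, hle⟩ ⟨L, hL, hfin, rfl⟩)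

theorem IsChowForm.degree_ne_zero [Nontrivial σ] (hF : IsChowForm V F) : degree V ≠ 0 := by
  classical
  intro h0
  have hsupp : ∀ m ∈ F.support, m = 0 := by
    intro m hm
    ext q
    have := hF.isWeightedHomogeneous q.1 (mem_support_iff.mp hm)
    rw [h0, Finsupp.weight_apply, Finsupp.sum, Finset.sum_eq_zero_iff] at this
    by_contra hq
    have h1 := this q (Finsupp.mem_support_iff.mpr hq)
    simp at h1
    exact hq h1
  have hC : F = C (coeff 0 F) := by
    ext m
    by_cases hm : m = 0
    · simp [hm]
    · rw [coeff_C, if_neg (Ne.symm hm)]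
      by_contra h
      exact hm (hsupp m (mem_support_iff.mpr h))
  apply hF.irreducible.not_isUnit
  rw [hC]
  refine IsUnit.map C (isUnit_iff_ne_zero.mpr fun h => hF.irreducible.ne_zero ?_)
  rw [hC, h, map_zero]

/-- A zero row makes both sides true: `F` has positive degree in that group, and the remaining `D`
hyperplanes already meet `V`. -/
theorem IsChowForm.rowEval_eq_zero_iff [Nontrivial σ] (hF : IsChowForm V F)
    (ξ : Fin (D + 1) → σ → ℂ) :
    rowEval ξ F = 0 ↔ ∃ v ∈ cone V, v ≠ 0 ∧ ∀ i, ξ i ⬝ᵥ v = 0 := by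
  by_cases h : ∀ i, ξ i ≠ 0
  · exact hF.rowEval_eq_zero_iff_of_ne_zero h
  · push Not at h
    obtain ⟨i, hi⟩ := h
    constructor
    · intro _
      obtain ⟨v, hv, hv0, h⟩ := hF.exists_mem_cone hF.degree_ne_zero (hF.isWeightedHomogeneous i) ξ
      refine ⟨v, hv, hv0, fun k => ?_⟩
      by_cases hk : k = i
      · rw [hk, hi, zero_dotProduct]
      · exact h k hk
    · intro _
      have := rowEval_update_smul (hF.isWeightedHomogeneous i) ξ 0
      rwa [zero_smul, ← hi, Function.update_eq_self, zero_pow hF.degree_ne_zero, zero_mul] at this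

end ChowDegree

/-! ### Hyperplanes through a point off the variety -/

section Sections

/-- Successive choice of elements of a linear system which raise the height. -/
theorem exists_forall_isPrime_le_height {A M : Type*} [CommRing A] [Algebra ℂ A]
    [IsNoetherianRing A] [AddCommGroup M] [Module ℂ M] (lin : M →ₗ[ℂ] A) (j : ℕ) :
    ∃ a : Fin j → M, ∀ P : Ideal A, P.IsPrime → (∀ k, lin (a k) ∈ P) →
      (∀ m, lin m ∈ P) ∨ (j : ℕ∞) ≤ P.height := by
  classical
  induction j with
  | zero => exact ⟨Fin.elim0, fun P _ _ => Or.inr (by simp)⟩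
  | succ j ih =>
    obtain ⟨a, ha⟩ := ih
    let J : Ideal A := Ideal.span (Set.range fun k => lin (a k))
    have hfin : J.minimalPrimes.Finite := J.finite_minimalPrimes_of_isNoetherianRing
    -- These are finitely many proper subspaces, which cannot cover a vector space over `ℂ`. An
    -- element outside them avoids every minimal prime of `J` not containing the whole system.
    let s : Finset (Submodule ℂ M) := (hfin.toFinset.image fun P : Ideal A =>
      (P.restrictScalars ℂ).comap lin).filter (· ≠ ⊤)
    have hs := Subspace.biUnion_ne_univ_of_top_notMem (k := ℂ) (E := M) (s := s) (by simp [s])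
    obtain ⟨m, hm⟩ := (Set.ne_univ_iff_exists_notMem _).mp hs
    refine ⟨Fin.snoc a m, fun P hP hPa => ?_⟩
    have h1 : ∀ k, lin (a k) ∈ P := fun k => by simpa using hPa k.castSucc
    have h2 : lin m ∈ P := by simpa using hPa (Fin.last j)
    have hJP : J ≤ P := Ideal.span_le.mpr (by rintro _ ⟨k, rfl⟩; exact h1 k)
    obtain ⟨Q, hQ, hQP⟩ := Ideal.exists_minimalPrimes_le hJP
    have hQp : Q.IsPrime := hQ.1.1
    by_cases hQE : ∀ m, lin m ∈ Q
    · exact Or.inl fun m => hQP (hQE m)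
    right
    have h3 : (j : ℕ∞) ≤ Q.height := (ha Q hQp fun k =>
      hQ.1.2 (Ideal.subset_span ⟨k, rfl⟩)).resolve_left hQE
    have h4 : lin m ∉ Q := by
      intro h
      apply hm
      simp only [Set.mem_iUnion]
      refine ⟨(Q.restrictScalars ℂ).comap lin, ?_, h⟩
      simp only [s, Finset.mem_filter, Finset.mem_image, Set.Finite.mem_toFinset]
      refine ⟨⟨Q, hQ, rfl⟩, fun ht => hQE fun m => ?_⟩
      have : m ∈ (Q.restrictScalars ℂ).comap lin := ht ▸ Submodule.mem_top
      exact this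
    have h5 : Q < P := lt_of_le_of_ne hQP fun h => h4 (h ▸ h2)
    have h6 := Ideal.height_add_one_le_of_lt_of_isPrime h5
    push_cast
    exact (add_le_add_left h3 1).trans h6

variable {σ : Type}

/-- The restriction of polynomials to the line spanned by `v`. -/
def restrictLine (v : σ → ℂ) : MvPolynomial σ ℂ →ₐ[ℂ] Polynomial ℂ :=
  aeval fun j => Polynomial.C (v j) * Polynomial.X

theorem eval_restrictLine (v : σ → ℂ) (f : MvPolynomial σ ℂ) (t : ℂ) :
    (restrictLine v f).eval t = eval (t • v) f := by
  induction f using MvPolynomial.induction_on with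
  | C a => simp [restrictLine]
  | add p q hp hq => simp only [map_add, Polynomial.eval_add] at *; rw [hp, hq]
  | mul_X p q hp =>
    simp only [map_mul, Polynomial.eval_mul] at *
    rw [hp]
    simp [restrictLine]
    exact Or.inl (mul_comm _ _)

variable [Fintype σ]

/-- The linear form with given coefficients. -/
def linearForm : (σ → ℂ) →ₗ[ℂ] MvPolynomial σ ℂ where
  toFun a := ∑ j, C (a j) * X j
  map_add' a b := by simp [add_mul, Finset.sum_add_distrib]
  map_smul' c a := by simp [Finset.smul_sum, smul_eq_C_mul, mul_assoc]

theorem restrictLine_linearForm (v a : σ → ℂ) :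
    restrictLine v (linearForm a) = Polynomial.C (a ⬝ᵥ v) * Polynomial.X := by
  apply Polynomial.funext
  intro t
  rw [eval_restrictLine, Polynomial.eval_mul, Polynomial.eval_C, Polynomial.eval_X]
  simp only [linearForm, LinearMap.coe_mk, AddHom.coe_mk, map_sum, map_mul, eval_C, eval_X,
    Pi.smul_apply, smul_eq_mul, dotProduct, Finset.sum_mul]
  exact Finset.sum_congr rfl fun j _ => by ring

theorem eq_smul_of_forall_dotProduct {p v : σ → ℂ} (hp : p ≠ 0)
    (h : ∀ a : σ → ℂ, a ⬝ᵥ p = 0 → a ⬝ᵥ v = 0) : ∃ c : ℂ, v = c • p := by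
  classical
  obtain ⟨j, hj⟩ := Function.ne_iff.mp hp
  have hj' : p j ≠ 0 := hj
  refine ⟨v j / p j, ?_⟩
  ext i
  have := h (p j • Pi.single i 1 - p i • Pi.single j 1) (by simp [sub_dotProduct, mul_comm])
  simp [sub_dotProduct] at this
  rw [Pi.smul_apply, smul_eq_mul]
  field_simp
  linear_combination this

variable {V : Set (PSpace σ)} {D : ℕ} {F : MvPolynomial (Fin (D + 1) × σ) ℂ}

/-- Through a point outside a variety of dimension `D` there pass `D + 1` hyperplanes without common
point on the variety. -/
theorem exists_dotProduct_eq_zero_of_notMem_cone (hD : HasDim V D) {p : σ → ℂ}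
    (hp : p ∉ cone V) : ∃ ξ : Fin (D + 1) → σ → ℂ, (∀ i, ξ i ⬝ᵥ p = 0) ∧
      ∀ v ∈ cone V, v ≠ 0 → ∃ i, ξ i ⬝ᵥ v ≠ 0 := by
  have hp0 : p ≠ 0 := by
    rintro rfl
    exact hp zero_mem_cone
  let I := vanishingIdeal ℂ (cone V)
  let E : Submodule ℂ (σ → ℂ) :=
    { carrier := {a | a ⬝ᵥ p = 0}
      add_mem' := fun {a b} ha hb => by
        rw [Set.mem_ofPred_eq] at *
        rw [add_dotProduct, ha, hb, add_zero]
      zero_mem' := zero_dotProduct p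
      smul_mem' := fun c a ha => by
        rw [Set.mem_ofPred_eq] at *
        rw [smul_dotProduct, ha, smul_zero] }
  let lin : E →ₗ[ℂ] MvPolynomial σ ℂ ⧸ I :=
    (Ideal.Quotient.mkₐ ℂ I).toLinearMap ∘ₗ linearForm ∘ₗ E.subtype
  obtain ⟨a, ha⟩ := exists_forall_isPrime_le_height lin (D + 1)
  refine ⟨fun i => a i, fun i => (a i).2, fun v hv hv0 => ?_⟩
  by_contra! hav
  let φ : MvPolynomial σ ℂ ⧸ I →ₐ[ℂ] Polynomial ℂ := Ideal.Quotient.liftₐ I (restrictLine v) (by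
    intro f hf
    apply Polynomial.funext
    intro t
    rw [eval_restrictLine, Polynomial.eval_zero]
    exact hf _ (smul_mem_cone hv t))
  have hφ : ∀ f, φ (Ideal.Quotient.mk I f) = restrictLine v f := fun f => rfl
  -- `P` and `m` are the ideals of the line through `v` and of the origin. Either all linear forms
  -- vanishing at `p` vanish at `v`, so `v` is proportional to `p`, or `P` has height at least `D +
  -- 1`; then `m` has height at least `D + 2` in a ring of dimension `D + 1`.
  let P := RingHom.ker φ.toRingHom
  let m := RingHom.ker ((Polynomial.evalRingHom (0 : ℂ)).comp φ.toRingHom)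
  have hP : P.IsPrime := RingHom.ker_isPrime _
  have hm : m.IsPrime := RingHom.ker_isPrime _
  have hlin : ∀ x : E, lin x ∈ P ↔ x.1 ⬝ᵥ v = 0 := by
    intro x
    change φ (Ideal.Quotient.mk I (linearForm x.1)) = 0 ↔ _
    rw [hφ, restrictLine_linearForm]
    simp
  rcases ha P hP fun k => (hlin _).mpr (hav k) with h | h
  · obtain ⟨c, rfl⟩ := eq_smul_of_forall_dotProduct hp0 fun x hx => (hlin ⟨x, hx⟩).mp (h ⟨x, hx⟩)
    apply hp
    have hc : c ≠ 0 := fun hc => hv0 (by rw [hc, zero_smul])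
    have := smul_mem_cone hv c⁻¹
    rwa [smul_smul, inv_mul_cancel₀ hc, one_smul] at this
  · have hPm : P < m := by
      refine lt_of_le_of_ne (fun f hf => ?_) fun heq => ?_
      · have hf' : φ f = 0 := hf
        change (φ f).eval 0 = 0
        rw [hf', Polynomial.eval_zero]
      · obtain ⟨j, hj⟩ := Function.ne_iff.mp hv0
        have h1 : Ideal.Quotient.mk I (X j) ∈ m := by
          change (φ (Ideal.Quotient.mk I (X j))).eval 0 = 0
          rw [hφ, eval_restrictLine]
          simp
        rw [← heq] at h1
        have h2 : φ (Ideal.Quotient.mk I (X j)) = 0 := h1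
        rw [hφ] at h2
        have h3 := eval_restrictLine v (X j) 1
        rw [h2] at h3
        simp at h3
        exact hj h3.symm
    have h1 := Ideal.height_add_one_le_of_lt_of_isPrime hPm
    have h2 : (m.height : WithBot ℕ∞) ≤ (D : WithBot ℕ∞) + 1 := by
      rw [← hD]
      exact Ideal.height_le_ringKrullDim_of_ne_top hm.ne_top
    have h3 : m.height ≤ (D + 1 : ℕ) := by exact_mod_cast h2
    have h4 : ((D + 1 : ℕ) : ℕ∞) + 1 ≤ (D + 1 : ℕ) := (add_le_add_left h 1).trans (h1.trans h3)
    have h5 : D + 1 + 1 ≤ D + 1 := by exact_mod_cast h4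
    omega

end Sections

/-! ### Homogeneous vanishing ideals -/

section VanishingIdeal

variable {σ : Type} {V Z : Set (PSpace σ)}

theorem restrictLine_of_isHomogeneous {f : MvPolynomial σ ℂ} {e : ℕ} (hf : f.IsHomogeneous e)
    (v : σ → ℂ) : restrictLine v f = Polynomial.C (eval v f) * Polynomial.X ^ e := by
  apply Polynomial.funext
  intro t
  rw [eval_restrictLine, eval_smul_of_isHomogeneous hf, mul_comm]
  simp

theorem coeff_restrictLine (v : σ → ℂ) (f : MvPolynomial σ ℂ) (e : ℕ) :
    (restrictLine v f).coeff e = eval v (homogeneousComponent e f) := by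
  classical
  conv_lhs => rw [← sum_homogeneousComponent f, map_sum, Polynomial.finsetSum_coeff]
  simp_rw [restrictLine_of_isHomogeneous (homogeneousComponent_isHomogeneous _ f),
    Polynomial.coeff_C_mul, Polynomial.coeff_X_pow]
  simp only [mul_ite, mul_one, mul_zero, Finset.sum_ite_eq, Finset.mem_range, ite_eq_left_iff]
  intro h
  rw [homogeneousComponent_eq_zero _ _ (by omega), map_zero]

theorem homogeneousComponent_mem_vanishingIdeal {f : MvPolynomial σ ℂ}
    (hf : f ∈ vanishingIdeal ℂ (cone V)) (e : ℕ) :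
    homogeneousComponent e f ∈ vanishingIdeal ℂ (cone V) := by
  intro v hv
  change eval v _ = 0
  rw [← coeff_restrictLine]
  have : restrictLine v f = 0 := Polynomial.funext fun t => by
    rw [eval_restrictLine, Polynomial.eval_zero]
    exact hf _ (smul_mem_cone hv t)
  rw [this, Polynomial.coeff_zero]

theorem isProjClosed_setOf_eval_rep {f : MvPolynomial σ ℂ} {e : ℕ} (hf : f.IsHomogeneous e) :
    IsProjClosed {p : PSpace σ | eval p.rep f = 0} :=
  ⟨{f}, by rintro _ rfl; exact ⟨e, hf⟩, by simp⟩

theorem mem_vanishingIdeal_of_forall_rep (hV : V.Nonempty) {f : MvPolynomial σ ℂ} {e : ℕ}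
    (hf : f.IsHomogeneous e) (h : ∀ p ∈ V, eval p.rep f = 0) :
    f ∈ vanishingIdeal ℂ (cone V) := by
  intro v hv
  change eval v f = 0
  by_cases hv0 : v = 0
  · obtain ⟨p, hp⟩ := hV
    have := eval_smul_of_isHomogeneous hf 0 p.rep
    rwa [h p hp, mul_zero, zero_smul, ← hv0] at this
  · obtain ⟨a, ha⟩ := Projectivization.exists_smul_eq_mk_rep ℂ v hv0
    have h1 := h _ (hv hv0)
    rw [← ha] at h1
    have h2 : eval (a • v) f = (a : ℂ) ^ e * eval v f := eval_smul_of_isHomogeneous hf a v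
    rw [h2] at h1
    simpa using h1

attribute [local instance] MvPolynomial.gradedAlgebra

/-- Primality of a homogeneous ideal may be tested on homogeneous elements; their zero sets are
closed in projective space, where irreducibility of `V` applies. -/
theorem IsIrredVariety.isPrime_vanishingIdeal (hV : IsIrredVariety V) :
    (vanishingIdeal ℂ (cone V)).IsPrime := by
  apply Ideal.IsHomogeneous.isPrime_of_homogeneous_mem_or_mem (𝒜 := homogeneousSubmodule σ ℂ)
  · intro e f hf
    have := homogeneousComponent_mem_vanishingIdeal hf e
    rw [← decomposition.decompose'_apply] at this
    exact this
  · intro h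
    have : (1 : MvPolynomial σ ℂ) ∈ vanishingIdeal ℂ (cone V) := h ▸ Submodule.mem_top
    simpa using this 0 zero_mem_cone
  · rintro x y ⟨e, hx⟩ ⟨e', hy⟩ hxy
    rcases hV.irred _ _ (isProjClosed_setOf_eval_rep hx) (isProjClosed_setOf_eval_rep hy) (by
      intro p hp
      have : eval p.rep (x * y) = 0 := hxy _ (rep_mem_cone_iff.mpr hp)
      rw [map_mul] at this
      exact mul_eq_zero.mp this) with h | h
    · exact Or.inl (mem_vanishingIdeal_of_forall_rep hV.nonempty hx h)
    · exact Or.inr (mem_vanishingIdeal_of_forall_rep hV.nonempty hy h)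

/-- A proper closed subset of an irreducible variety has smaller dimension. -/
theorem coneDim_add_one_le (hV : IsProjClosed V) (hVZ : V ⊆ Z) (hne : V ≠ Z)
    (hZ : (vanishingIdeal ℂ (cone Z)).IsPrime) : coneDim V + 1 ≤ coneDim Z := by
  have hle : vanishingIdeal ℂ (cone Z) ≤ vanishingIdeal ℂ (cone V) :=
    vanishingIdeal_anti_mono (cone_subset_cone.mpr hVZ)
  obtain ⟨S, -, hS⟩ := hV.exists_cone
  obtain ⟨f, hfV, hfZ⟩ : ∃ f ∈ vanishingIdeal ℂ (cone V), f ∉ vanishingIdeal ℂ (cone Z) := by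
    by_contra! h
    apply hne
    refine hVZ.antisymm (cone_subset_cone.mp fun v hv => ?_)
    rw [hS]
    intro f hf
    exact h f (fun u hu => (hS u).mp hu f hf) v hv
  have : IsDomain (MvPolynomial σ ℂ ⧸ vanishingIdeal ℂ (cone Z)) :=
    (Ideal.Quotient.isDomain_iff_prime _).mpr hZ
  refine ringKrullDim_succ_le_of_surjective (Ideal.Quotient.factor hle)
    (Ideal.Quotient.factor_surjective hle) (r := Ideal.Quotient.mk _ f) ?_ ?_
  · rw [mem_nonZeroDivisors_iff_ne_zero, Ne, Ideal.Quotient.eq_zero_iff_mem]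
    exact hfZ
  · rw [Ideal.Quotient.factor_mk, Ideal.Quotient.eq_zero_iff_mem]
    exact hfV

end VanishingIdeal

/-! ### Cones, coordinate rings and dimensions of joins -/

section Join

variable {σ τ : Type}

theorem mem_cone_join_univ {W : Set (PSpace τ)} {v : σ ⊕ τ → ℂ} :
    v ∈ cone (join (Set.univ : Set (PSpace σ)) W) ↔ v ∘ Sum.inr ∈ cone W := by
  by_cases hv : v = 0
  · subst hv
    exact ⟨fun _ => zero_mem_cone, fun _ => zero_mem_cone⟩
  rw [← mk_mem_iff hv]
  constructor
  · rintro ⟨y, -, w, hw, h, heq⟩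
    obtain ⟨a, rfl⟩ := (Projectivization.mk_eq_mk_iff' ℂ _ _ _ _).mp heq
    exact smul_mem_cone hw a
  · intro h
    have hv' : Sum.elim (v ∘ Sum.inl) (v ∘ Sum.inr) = v := Sum.elim_comp_inl_inr v
    exact ⟨v ∘ Sum.inl, fun _ => Set.mem_univ _, v ∘ Sum.inr, h, by rwa [hv'], by simp only [hv']⟩

theorem mem_cone_embR_image {X : Set (PSpace τ)} {v : σ ⊕ τ → ℂ} :
    v ∈ cone (embR σ τ '' X) ↔ v ∘ Sum.inl = 0 ∧ v ∘ Sum.inr ∈ cone X := by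
  by_cases hv : v = 0
  · subst hv
    exact ⟨fun _ => ⟨rfl, zero_mem_cone⟩, fun _ => zero_mem_cone⟩
  rw [← mk_mem_iff hv]
  constructor
  · rintro ⟨p, hp, h⟩
    induction p using Projectivization.ind with
    | h w hw =>
      rw [embR, Projectivization.map_mk] at h
      obtain ⟨a, ha⟩ := (Projectivization.mk_eq_mk_iff' ℂ _ _ _ _).mp h.symm
      subst ha
      refine ⟨?_, smul_mem_cone ((mk_mem_iff hw).mp hp) a⟩
      ext i
      simp [inrLinear]
  · rintro ⟨h1, h2⟩
    have hv' : Sum.elim (0 : σ → ℂ) (v ∘ Sum.inr) = v := by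
      rw [← h1]; exact Sum.elim_comp_inl_inr v
    have h0 : v ∘ Sum.inr ≠ 0 := by
      intro h
      rw [h] at hv'
      exact hv (by rw [← hv']; ext (i | i) <;> rfl)
    refine ⟨Projectivization.mk ℂ _ h0, h2 h0, ?_⟩
    rw [embR, Projectivization.map_mk]
    congr 1

theorem mem_cone_embR_preimage {V : Set (PSpace (σ ⊕ τ))} {w : τ → ℂ} :
    w ∈ cone (embR σ τ ⁻¹' V) ↔ Sum.elim (0 : σ → ℂ) w ∈ cone V := by
  by_cases hw : w = 0
  · subst hw
    have h0 : (Sum.elim 0 0 : σ ⊕ τ → ℂ) = 0 := by ext (i | i) <;> rfl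
    rw [h0]
    exact ⟨fun _ => zero_mem_cone, fun _ => zero_mem_cone⟩
  have h0 : (Sum.elim 0 w : σ ⊕ τ → ℂ) ≠ 0 := by
    intro h
    exact hw (funext fun j => congrFun h (Sum.inr j))
  rw [← mk_mem_iff hw, ← mk_mem_iff h0]
  rfl

theorem mem_cone_inter {V W : Set (PSpace σ)} {v : σ → ℂ} :
    v ∈ cone (V ∩ W) ↔ v ∈ cone V ∧ v ∈ cone W :=
  ⟨fun h => ⟨fun h0 => (h h0).1, fun h0 => (h h0).2⟩, fun h h0 => ⟨h.1 h0, h.2 h0⟩⟩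

theorem ringKrullDim_quotient_eq_of_ker {R S : Type*} [CommRing R] [CommRing S] {f : R →+* S}
    (hf : Function.Surjective f) {J : Ideal R} (hJ : RingHom.ker f = J) :
    ringKrullDim (R ⧸ J) = ringKrullDim S := by
  subst hJ
  exact ringKrullDim_eq_of_ringEquiv (RingHom.quotientKerEquivOfSurjective hf)

theorem coneDim_embR_image (X : Set (PSpace τ)) : coneDim (embR σ τ '' X) = coneDim X := by
  let g : MvPolynomial (σ ⊕ τ) ℂ →ₐ[ℂ] MvPolynomial τ ℂ := aeval (Sum.elim 0 MvPolynomial.X)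
  have hg : ∀ f y, eval y (g f) = eval (Sum.elim 0 y) f := by
    intro f y
    induction f using MvPolynomial.induction_on with
    | C a => simp [g]
    | add p q hp hq => simp only [map_add]; rw [hp, hq]
    | mul_X p q hp =>
      simp only [map_mul]
      rw [hp]
      rcases q with i | i <;> simp [g]
  have hsurj : Function.Surjective g := by
    intro f
    refine ⟨rename Sum.inr f, ?_⟩
    simp only [g, aeval_rename, Sum.elim_comp_inr]
    exact aeval_X_left_apply f
  refine ringKrullDim_quotient_eq_of_ker
    (f := (Ideal.Quotient.mk (vanishingIdeal ℂ (cone X))).comp g.toRingHom)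
    (Ideal.Quotient.mk_surjective.comp hsurj) ?_
  ext f
  rw [RingHom.mem_ker, RingHom.comp_apply, Ideal.Quotient.eq_zero_iff_mem]
  constructor
  · intro h v hv
    obtain ⟨h1, h2⟩ := mem_cone_embR_image.mp hv
    have h3 : eval (v ∘ Sum.inr) (g f) = 0 := h _ h2
    rw [hg, ← h1, Sum.elim_comp_inl_inr] at h3
    exact h3
  · intro h y hy
    change eval y (g f) = 0
    rw [hg]
    exact h _ (mem_cone_embR_image.mpr ⟨rfl, hy⟩)

/-- The map from the coordinates of a join with projective space to a polynomial ring over a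
quotient of the second coordinate ring. -/
def joinRingHom (σ : Type) {τ : Type} {Q : Type} [CommRing Q] (π : MvPolynomial τ ℂ →+* Q) :
    MvPolynomial (σ ⊕ τ) ℂ →+* MvPolynomial σ Q :=
  (MvPolynomial.map π).comp (sumAlgEquiv ℂ σ τ).toAlgHom.toRingHom

theorem joinRingHom_surjective {Q : Type} [CommRing Q] {π : MvPolynomial τ ℂ →+* Q}
    (hπ : Function.Surjective π) : Function.Surjective (joinRingHom σ π) :=
  (MvPolynomial.map_surjective _ hπ).comp (sumAlgEquiv ℂ σ τ).surjective

theorem eval_sumAlgEquiv (f : MvPolynomial (σ ⊕ τ) ℂ) (x : σ → ℂ) (y : τ → ℂ) :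
    eval x (MvPolynomial.map (eval y) (sumAlgEquiv ℂ σ τ f)) = eval (Sum.elim x y) f := by
  induction f using MvPolynomial.induction_on with
  | C a => simp [sumAlgEquiv_C_inl]
  | add p q hp hq => simp only [map_add]; rw [hp, hq]
  | mul_X p q hp =>
    simp only [map_mul]
    rw [hp]
    rcases q with i | i <;> simp [sumAlgEquiv_X_inl, sumAlgEquiv_X_inr]

/-- The cone over the join is `ℂ^σ × cone W`, so vanishing on it means that all coefficients with
respect to the first variables vanish on `cone W`. The coordinate ring of the join is thus a
polynomial ring over that of `W`, which yields its dimension and primality. -/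
theorem ker_joinRingHom {Q : Type} [CommRing Q] {π : MvPolynomial τ ℂ →+* Q}
    {W : Set (PSpace τ)} (hπ : RingHom.ker π = vanishingIdeal ℂ (cone W)) :
    RingHom.ker (joinRingHom σ π) =
      vanishingIdeal ℂ (cone (join (Set.univ : Set (PSpace σ)) W)) := by
  ext f
  have h1 : f ∈ RingHom.ker (joinRingHom σ π) ↔
      ∀ m, coeff m (sumAlgEquiv ℂ σ τ f) ∈ vanishingIdeal ℂ (cone W) := by
    rw [RingHom.mem_ker, MvPolynomial.ext_iff]
    refine forall_congr' fun m => ?_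
    rw [← hπ, RingHom.mem_ker, coeff_zero]
    simp [joinRingHom, coeff_map]
  rw [h1]
  constructor
  · intro h v hv
    rw [mem_cone_join_univ] at hv
    change eval v f = 0
    rw [← Sum.elim_comp_inl_inr v, ← eval_sumAlgEquiv]
    have : MvPolynomial.map (eval (v ∘ Sum.inr)) (sumAlgEquiv ℂ σ τ f) = 0 := by
      ext m
      rw [coeff_map, coeff_zero]
      exact h m _ hv
    rw [this, map_zero]
  · intro h m y hy
    change eval y _ = 0
    have : MvPolynomial.map (eval y) (sumAlgEquiv ℂ σ τ f) = 0 := by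
      apply MvPolynomial.funext
      intro x
      rw [eval_sumAlgEquiv, map_zero]
      exact h _ (mem_cone_join_univ.mpr hy)
    rw [← coeff_map, this, coeff_zero]

theorem coneDim_join_univ_eq_ringKrullDim [Finite σ] {Q : Type} [CommRing Q] [IsNoetherianRing Q]
    {π : MvPolynomial τ ℂ →+* Q} (hs : Function.Surjective π) {W : Set (PSpace τ)}
    (hπ : RingHom.ker π = vanishingIdeal ℂ (cone W)) :
    coneDim (join (Set.univ : Set (PSpace σ)) W) = ringKrullDim Q + (Nat.card σ : ℕ) := by
  rw [coneDim, ringKrullDim_quotient_eq_of_ker (joinRingHom_surjective hs) (ker_joinRingHom hπ),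
    MvPolynomial.ringKrullDim_of_isNoetherianRing]

theorem coneDim_join_univ [Finite σ] [Finite τ] (W : Set (PSpace τ)) :
    coneDim (join (Set.univ : Set (PSpace σ)) W) = coneDim W + (Nat.card σ : ℕ) :=
  coneDim_join_univ_eq_ringKrullDim Ideal.Quotient.mk_surjective Ideal.mk_ker

theorem isPrime_vanishingIdeal_join {W : Set (PSpace τ)}
    (hW : (vanishingIdeal ℂ (cone W)).IsPrime) :
    (vanishingIdeal ℂ (cone (join (Set.univ : Set (PSpace σ)) W))).IsPrime := by
  rw [← ker_joinRingHom (Ideal.mk_ker (I := vanishingIdeal ℂ (cone W)))]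
  have : IsDomain (MvPolynomial τ ℂ ⧸ vanishingIdeal ℂ (cone W)) :=
    (Ideal.Quotient.isDomain_iff_prime _).mpr hW
  exact RingHom.ker_isPrime _

end Join

/-! ### The scaling action on vectors and forms -/

section Scaling

variable {σ τ : Type} {D : ℕ}

/-- Multiplication of the first group of coordinates by `t`. -/
def scaleVec (t : ℂ) (v : σ ⊕ τ → ℂ) : σ ⊕ τ → ℂ := Sum.elim (t • v ∘ Sum.inl) (v ∘ Sum.inr)

theorem rowEval_scaleForm (t : ℂ) (ξ : Fin (D + 1) → σ ⊕ τ → ℂ)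
    (F : MvPolynomial (Fin (D + 1) × (σ ⊕ τ)) ℂ) :
    rowEval ξ (scaleForm t F) = rowEval (fun i => scaleVec t (ξ i)) F := by
  simp only [rowEval, scaleForm, eval, eval₂Hom_bind₁]
  congr 2
  ext ⟨k, i | i⟩ <;> simp [scaleVec]

theorem scaleForm_mul (t : ℂ) (F G : MvPolynomial (Fin (D + 1) × (σ ⊕ τ)) ℂ) :
    scaleForm t (F * G) = scaleForm t F * scaleForm t G :=
  map_mul (bind₁ _) F G

theorem scaleForm_scaleForm_inv {t : ℂ} (ht : t ≠ 0)
    (F : MvPolynomial (Fin (D + 1) × (σ ⊕ τ)) ℂ) : scaleForm t (scaleForm t⁻¹ F) = F := by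
  apply MvPolynomial.funext
  intro x
  change rowEval (fun i j => x (i, j)) _ = rowEval (fun i j => x (i, j)) _
  rw [rowEval_scaleForm, rowEval_scaleForm]
  congr 2
  ext i (j | j)
  · simp [scaleVec, ht]
  · simp [scaleVec]

theorem dotProduct_scaleVec [Fintype σ] [Fintype τ] (t : ℂ) (u v : σ ⊕ τ → ℂ) :
    scaleVec t u ⬝ᵥ v = u ⬝ᵥ scaleVec t v := by
  simp only [scaleVec, dotProduct, Fintype.sum_sum_type, Sum.elim_inl, Sum.elim_inr,
    Pi.smul_apply, Function.comp_apply, smul_eq_mul]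
  congr 1
  exact Finset.sum_congr rfl fun i _ => by ring

theorem scaleVec_ne_zero {t : ℂ} (ht : t ≠ 0) {v : σ ⊕ τ → ℂ} (hv : v ≠ 0) : scaleVec t v ≠ 0 := by
  intro h
  apply hv
  ext (i | i)
  · have := congrFun h (Sum.inl i)
    simpa [scaleVec, ht] using this
  · exact congrFun h (Sum.inr i)

/-- By the Nullstellensatz the prime ideal generated by `F` is the full vanishing ideal of its zero
set. -/
theorem dvd_of_forall_eval_eq_zero {ι : Type*} [Finite ι] {F G : MvPolynomial ι ℂ}
    (hF : Irreducible F) (h : ∀ x, eval x F = 0 → eval x G = 0) : F ∣ G := by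
  have hp : (Ideal.span {F}).IsPrime := (Ideal.span_singleton_prime hF.ne_zero).mpr hF.prime
  rw [← Ideal.mem_span_singleton, ← IsPrime.vanishingIdeal_zeroLocus (K := ℂ) (Ideal.span {F})]
  intro x hx
  exact h x (hx F (Ideal.mem_span_singleton_self F))

/-- If `F` divides all its rescalings, then these are constant multiples of `F`. -/
theorem exists_scaleForm_eq_C_mul {F : MvPolynomial (Fin (D + 1) × (σ ⊕ τ)) ℂ}
    (h : ∀ t : ℂ, t ≠ 0 → F ∣ scaleForm t F) {t : ℂ} (ht : t ≠ 0) :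
    ∃ c : ℂ, scaleForm t F = C c * F := by
  have h1 : scaleForm t F ∣ F := by
    obtain ⟨G, hG⟩ := h t⁻¹ (inv_ne_zero ht)
    refine ⟨scaleForm t G, ?_⟩
    have := congrArg (scaleForm t) hG
    rw [scaleForm_scaleForm_inv ht] at this
    rwa [scaleForm_mul] at this
  obtain ⟨u, hu⟩ := associated_of_dvd_dvd (h t ht) h1
  obtain ⟨c, -, hc⟩ := isUnit_iff_eq_C_of_isReduced.mp u.isUnit
  exact ⟨c, by rw [← hu, hc, mul_comm]⟩

end Scaling

/-! ### The Chow form of a join -/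

section Forward

variable {σ τ : Type} [Fintype σ] [Fintype τ] {D : ℕ}

theorem IsChowForm.rowEval_smul_rows {ι : Type} [Fintype ι] [Nontrivial ι] {V : Set (PSpace ι)}
    {F : MvPolynomial (Fin (D + 1) × ι) ℂ} (hF : IsChowForm V F) (t : ℂ)
    (ξ : Fin (D + 1) → ι → ℂ) (s : Finset (Fin (D + 1))) :
    rowEval (fun k => if k ∈ s then t • ξ k else ξ k) F =
      t ^ (s.card * degree V) * rowEval ξ F := by
  induction s using Finset.induction_on with
  | empty => simp
  | insert i s hi ih =>
    have h := rowEval_update_smul (hF.isWeightedHomogeneous i)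
      (fun k => if k ∈ s then t • ξ k else ξ k) t
    rw [ih] at h
    rw [Finset.card_insert_of_notMem hi, add_mul, one_mul, pow_add,
      mul_comm (t ^ (s.card * degree V)), mul_assoc, ← h]
    congr 2
    ext k j
    by_cases hk : k = i
    · subst hk; simp [hi]
    · simp [hk]

theorem dotProduct_sum (u v : σ ⊕ τ → ℂ) :
    u ⬝ᵥ v = (u ∘ Sum.inl) ⬝ᵥ (v ∘ Sum.inl) + (u ∘ Sum.inr) ⬝ᵥ (v ∘ Sum.inr) := by
  simp [dotProduct, Fintype.sum_sum_type]

variable {V : Set (PSpace (σ ⊕ τ))} {F : MvPolynomial (Fin (D + 1) × (σ ⊕ τ)) ℂ}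

/-- For a join there is a tuple of hyperplanes without common point on it, `card σ` of which are
defined by the first and the others by the second coordinates. -/
theorem IsChowForm.exists_split_rows [Nontrivial (σ ⊕ τ)] (hF : IsChowForm V F)
    {W : Set (PSpace τ)} (hV : V = join (Set.univ : Set (PSpace σ)) W) :
    ∃ (ξ : Fin (D + 1) → σ ⊕ τ → ℂ) (s : Finset (Fin (D + 1))), s.card = Fintype.card σ ∧
      rowEval ξ F ≠ 0 ∧ (∀ k ∈ s, ξ k ∘ Sum.inr = 0) ∧ ∀ k ∉ s, ξ k ∘ Sum.inl = 0 := by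
  classical
  have hcone : ∀ v, v ∈ cone V ↔ v ∘ Sum.inr ∈ cone W := fun v => by
    rw [hV, mem_cone_join_univ]
  obtain ⟨η, hη⟩ := exists_rowEval_ne_zero hF.irreducible.ne_zero
  let a : Fin (D + 1) → σ → ℂ := fun k => η k ∘ Sum.inl
  let b : Fin (D + 1) → τ → ℂ := fun k => η k ∘ Sum.inr
  have hmeet : ∀ (x : σ → ℂ) (y : τ → ℂ), y ∈ cone W → (∀ k, a k ⬝ᵥ x + b k ⬝ᵥ y = 0) →
      x = 0 ∧ y = 0 := by
    intro x y hy h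
    by_contra hne
    apply hη
    rw [hF.rowEval_eq_zero_iff]
    refine ⟨Sum.elim x y, (hcone _).mpr hy, ?_, fun k => ?_⟩
    · intro h0
      exact hne ⟨funext fun i => congrFun h0 (Sum.inl i), funext fun i => congrFun h0 (Sum.inr i)⟩
    · rw [dotProduct_sum]
      exact h k
  -- Otherwise a nonzero `x` orthogonal to all `a k` gives the common point `(x, 0)`, which lies in
  -- the cone over the join.
  have hspan : Submodule.span ℂ (Set.range a) = ⊤ := by
    by_contra hne
    obtain ⟨f, hf0, hf⟩ := Submodule.exists_le_ker_of_lt_top _ (lt_top_iff_ne_top.mpr hne)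
    apply hf0
    have := (hmeet (fun j => f (Pi.single j 1)) 0 zero_mem_cone (by
      intro k
      rw [dotProduct_zero, add_zero, dotProduct_comm, ← dual_apply_eq_dotProduct]
      exact hf (Submodule.subset_span ⟨k, rfl⟩))).1
    ext v
    rw [LinearMap.zero_comp, LinearMap.zero_apply]
    exact congrFun this v
  obtain ⟨κ, f, hinj, hκ, hind⟩ := exists_linearIndependent' ℂ a
  rw [hspan] at hκ
  let B := Module.Basis.mk hind hκ.ge
  have : Fintype κ := Fintype.ofInjective f hinj
  -- The rows in `s` amount to `x = -ψᵀ y`. Substituted into the others, this leaves `(b k - ψ (a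
  -- k)) ⬝ᵥ y = 0`, so a common point of the split rows would give one of the original rows.
  let ψ : (σ → ℂ) →ₗ[ℂ] (τ → ℂ) := B.constr ℂ (b ∘ f)
  have hψ : ∀ i, ψ (a (f i)) = b (f i) := by
    intro i
    have h1 : B i = a (f i) := Module.Basis.mk_apply _ _ _
    rw [← h1]
    exact B.constr_basis ℂ _ i
  let s : Finset (Fin (D + 1)) := Finset.univ.image f
  refine ⟨fun k => if k ∈ s then Sum.elim (a k) 0 else Sum.elim 0 (b k - ψ (a k)), s, ?_, ?_, ?_, ?_⟩
  · rw [Finset.card_image_of_injective _ hinj, Finset.card_univ,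
      ← Module.finrank_eq_card_basis B, Module.finrank_fintype_fun_eq_card]
  · rw [Ne, hF.rowEval_eq_zero_iff]
    rintro ⟨v, hv, hv0, h⟩
    have hx : v ∘ Sum.inl = 0 := by
      have hz : ∀ u : σ → ℂ, u ⬝ᵥ (v ∘ Sum.inl) = 0 := by
        intro u
        have hu : u ∈ Submodule.span ℂ (Set.range (a ∘ f)) := hκ ▸ Submodule.mem_top
        induction hu using Submodule.span_induction with
        | mem x hx =>
          obtain ⟨i, rfl⟩ := hx
          have := h (f i)
          rw [if_pos (by simp [s]), dotProduct_sum] at this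
          simpa using this
        | zero => exact zero_dotProduct _
        | add x y _ _ hx hy => rw [add_dotProduct, hx, hy, add_zero]
        | smul c x _ hx => rw [smul_dotProduct, hx, smul_zero]
      exact dotProduct_eq_zero _ fun u => by rw [dotProduct_comm]; exact hz u
    have hb : ∀ k, (b k - ψ (a k)) ⬝ᵥ (v ∘ Sum.inr) = 0 := by
      intro k
      by_cases hk : k ∈ s
      · obtain ⟨i, -, rfl⟩ := Finset.mem_image.mp hk
        rw [hψ, sub_self, zero_dotProduct]
      · have := h k
        rw [if_neg hk, dotProduct_sum] at this
        simpa using this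
    let φ : Module.Dual ℂ (σ → ℂ) :=
      { toFun := fun u => -(ψ u ⬝ᵥ (v ∘ Sum.inr))
        map_add' := fun u u' => by rw [map_add, add_dotProduct, neg_add]
        map_smul' := fun c u => by simp }
    have := (hmeet (fun j => φ (Pi.single j 1)) (v ∘ Sum.inr) ((hcone v).mp hv) (by
      intro k
      rw [dotProduct_comm, ← dual_apply_eq_dotProduct]
      have := hb k
      rw [sub_dotProduct] at this
      change -(ψ (a k) ⬝ᵥ (v ∘ Sum.inr)) + _ = 0
      linear_combination this)).2
    apply hv0
    rw [← Sum.elim_comp_inl_inr v, hx, this]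
    ext (i | i) <;> rfl
  · intro k hk
    simp [hk]
  · intro k hk
    simp [hk]

theorem IsChowForm.scaleForm_eq_of_join [Nontrivial (σ ⊕ τ)] (hF : IsChowForm V F)
    {W : Set (PSpace τ)} (hV : V = join (Set.univ : Set (PSpace σ)) W) {t : ℂ} (ht : t ≠ 0) :
    scaleForm t F = t ^ (Fintype.card σ * degree V) • F := by
  have hcone : ∀ v, v ∈ cone V ↔ v ∘ Sum.inr ∈ cone W := fun v => by
    rw [hV, mem_cone_join_univ]
  have hdvd : ∀ t : ℂ, t ≠ 0 → F ∣ scaleForm t F := by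
    intro t ht
    refine dvd_of_forall_eval_eq_zero hF.irreducible fun x hx => ?_
    change rowEval (fun i j => x (i, j)) _ = 0 at hx
    change rowEval (fun i j => x (i, j)) _ = 0
    rw [hF.rowEval_eq_zero_iff] at hx
    rw [rowEval_scaleForm, hF.rowEval_eq_zero_iff]
    obtain ⟨v, hv, hv0, h⟩ := hx
    refine ⟨scaleVec t⁻¹ v, (hcone _).mpr ((hcone v).mp hv), scaleVec_ne_zero (inv_ne_zero ht) hv0,
      fun i => ?_⟩
    rw [dotProduct_scaleVec]
    have : scaleVec t (scaleVec t⁻¹ v) = v := by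
      ext (i | i)
      · simp [scaleVec, ht]
      · simp [scaleVec]
    rw [this]
    exact h i
  obtain ⟨c, hc⟩ := exists_scaleForm_eq_C_mul hdvd ht
  obtain ⟨ξ, s, hs, hξ, h1, h2⟩ := hF.exists_split_rows hV
  -- On split rows, scaling the first coordinates multiplies exactly the rows in `s` by `t`.
  have h3 : (fun i => scaleVec t (ξ i)) = fun k => if k ∈ s then t • ξ k else ξ k := by
    ext k (j | j)
    · by_cases hk : k ∈ s
      · simp [hk, scaleVec]
      · have : ξ k (Sum.inl j) = 0 := congrFun (h2 k hk) j
        simp [hk, scaleVec, this]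
    · by_cases hk : k ∈ s
      · have : ξ k (Sum.inr j) = 0 := congrFun (h1 k hk) j
        simp [hk, scaleVec, this]
      · simp [hk, scaleVec]
  have h4 := congrArg (rowEval ξ) hc
  rw [rowEval_scaleForm, h3, hF.rowEval_smul_rows, hs, map_mul] at h4
  have h5 : rowEval ξ (C c) = c := by simp [rowEval]
  rw [h5] at h4
  rw [hc, mul_right_cancel₀ hξ h4, smul_eq_C_mul]

end Forward

/-! ### The projection from the vertex as a limit of rescalings -/

section Projection

variable {σ τ : Type} {V : Set (PSpace (σ ⊕ τ))} {Y : Set (PSpace τ)}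

/-- The limit of the rescalings as `t` tends to zero. -/
theorem scaleVec_zero_mem_cone (hV : IsProjClosed V) {v : σ ⊕ τ → ℂ}
    (h : ∀ t : ℂ, t ≠ 0 → scaleVec t v ∈ cone V) : scaleVec 0 v ∈ cone V := by
  obtain ⟨S, -, hS⟩ := hV.exists_cone
  rw [hS]
  intro f hf
  let g : Polynomial ℂ := aeval (Sum.elim (fun i => Polynomial.C (v (Sum.inl i)) * Polynomial.X)
    fun i => Polynomial.C (v (Sum.inr i))) f
  have hg : ∀ t, g.eval t = eval (scaleVec t v) f := by
    intro t
    simp only [g]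
    clear g hf
    induction f using MvPolynomial.induction_on with
    | C a => simp
    | add p q hp hq => simp only [map_add, Polynomial.eval_add]; rw [hp, hq]
    | mul_X p q hp =>
      simp only [map_mul, Polynomial.eval_mul]
      rw [hp]
      rcases q with i | i
      · simp [scaleVec]
        exact Or.inl (mul_comm _ _)
      · simp [scaleVec]
  have hg0 : g = 0 := by
    apply Polynomial.eq_zero_of_infinite_isRoot
    refine Set.Infinite.mono (s := {0}ᶜ) ?_ (Set.finite_singleton (0 : ℂ)).infinite_compl
    intro t ht
    change g.eval t = 0
    rw [hg]
    exact (hS _).mp (h t ht) f hf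
  rw [← hg, hg0, Polynomial.eval_zero]

theorem scaleVec_zero (v : σ ⊕ τ → ℂ) : scaleVec 0 v = Sum.elim (0 : σ → ℂ) (v ∘ Sum.inr) := by
  simp [scaleVec]

/-- Finiteness allows cancellation in the dimension equation of a proper intersection. The origin
lies in every cone, so the coordinate ring is nontrivial even for empty `Z`. -/
theorem exists_coneDim_eq_natCast {ι : Type} [Fintype ι] (Z : Set (PSpace ι)) :
    ∃ k : ℕ, coneDim Z = k := by
  have hne : vanishingIdeal ℂ (cone Z) ≠ ⊤ := by
    intro h
    have : (1 : MvPolynomial ι ℂ) ∈ vanishingIdeal ℂ (cone Z) := h ▸ Submodule.mem_top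
    simpa using this 0 zero_mem_cone
  have : Nontrivial (MvPolynomial ι ℂ ⧸ vanishingIdeal ℂ (cone Z)) :=
    Ideal.Quotient.nontrivial_iff.mpr hne
  have h0 : 0 ≤ coneDim Z := ringKrullDim_nonneg_of_nontrivial
  have h1 := coneDim_le Z
  generalize coneDim Z = x at h0 h1
  induction x with
  | bot => simp at h0
  | coe x =>
    induction x with
    | top => exact absurd h1 (by exact_mod_cast not_le_of_gt (ENat.natCast_lt_top _))
    | coe k => exact ⟨k, rfl⟩

/-- The central projection of a closed set, pulled back to the ambient space, is closed. -/
theorem isProjClosed_setOf_scaleVec_zero {A : Set (PSpace (σ ⊕ τ))} (hA : IsProjClosed A) :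
    IsProjClosed {p : PSpace (σ ⊕ τ) | scaleVec 0 p.rep ∈ cone A} := by
  obtain ⟨S, hS, hA⟩ := hA.exists_cone
  let g : MvPolynomial (σ ⊕ τ) ℂ →ₐ[ℂ] MvPolynomial (σ ⊕ τ) ℂ :=
    aeval (Sum.elim 0 fun j => X (Sum.inr j))
  have hg : ∀ f v, eval v (g f) = eval (scaleVec 0 v) f := by
    intro f v
    induction f using MvPolynomial.induction_on with
    | C a => simp [g]
    | add p q hp hq => simp only [map_add]; rw [hp, hq]
    | mul_X p q hp =>
      simp only [map_mul]
      rw [hp]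
      rcases q with i | i <;> simp [g, scaleVec]
  refine ⟨g '' S, ?_, ?_⟩
  · rintro _ ⟨f, hf, rfl⟩
    obtain ⟨e, he⟩ := hS f hf
    refine ⟨1 * (e + 1), he.aeval _ ?_⟩
    rintro (i | i)
    · exact isHomogeneous_zero _ _ _
    · exact isHomogeneous_X _ _
  · intro p
    rw [Set.forall_mem_image]
    simp_rw [hg]
    exact hA _

theorem isProjClosed_inter_embR_image (hV : IsProjClosed V)
    (hY : IsProjClosed Y) : IsProjClosed (V ∩ embR σ τ '' Y) := by
  obtain ⟨S, hS, hV⟩ := hV.exists_cone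
  obtain ⟨S', hS', hY⟩ := hY.exists_cone
  refine isProjClosed_of_cone (S ∪ rename Sum.inr '' S' ∪ Set.range fun i => MvPolynomial.X (Sum.inl i))
    ?_ ?_
  · rintro f ((hf | ⟨f, hf, rfl⟩) | ⟨i, rfl⟩)
    · obtain ⟨e, he⟩ := hS f hf
      exact ⟨e + 1, he⟩
    · obtain ⟨e, he⟩ := hS' f hf
      exact ⟨e + 1, he.rename_isHomogeneous⟩
    · exact ⟨1, isHomogeneous_X _ _⟩
  · intro v _
    rw [mem_cone_inter, mem_cone_embR_image, hV, hY]
    constructor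
    · rintro ⟨h1, h2, h3⟩ f ((hf | ⟨f, hf, rfl⟩) | ⟨i, rfl⟩)
      · exact h1 f hf
      · rw [eval_rename]; exact h3 f hf
      · simpa using congrFun h2 i
    · intro h
      refine ⟨fun f hf => h f (Or.inl (Or.inl hf)), ?_, fun f hf => ?_⟩
      · ext i
        simpa using h _ (Or.inr ⟨i, rfl⟩)
      · have := h _ (Or.inl (Or.inr ⟨f, hf, rfl⟩))
        rwa [eval_rename] at this

theorem mem_cone_inter_embR_preimage {w : τ → ℂ} :
    w ∈ cone (Y ∩ embR σ τ ⁻¹' V) ↔ w ∈ cone Y ∧ Sum.elim (0 : σ → ℂ) w ∈ cone V := by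
  rw [mem_cone_inter, mem_cone_embR_preimage]

theorem embR_image_inter_preimage :
    embR σ τ '' (Y ∩ embR σ τ ⁻¹' V) = V ∩ embR σ τ '' Y := by
  rw [Set.image_inter_preimage, Set.inter_comm]

end Projection

/-! ### From the weight of the Chow form back to the join -/

section Backward

variable {σ τ : Type} [Fintype σ] [Fintype τ] {D : ℕ}
  {V : Set (PSpace (σ ⊕ τ))} {Y : Set (PSpace τ)} {F : MvPolynomial (Fin (D + 1) × (σ ⊕ τ)) ℂ}

/-- If the rescalings of the Chow form are multiples of it, then the variety is invariant under
rescaling. -/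
theorem IsChowForm.scaleVec_mem_cone [Nontrivial (σ ⊕ τ)] (hF : IsChowForm V F) {N : ℕ}
    (h : ∀ t : ℂ, t ≠ 0 → scaleForm t F = t ^ N • F) {v : σ ⊕ τ → ℂ} (hv : v ∈ cone V)
    {t : ℂ} (ht : t ≠ 0) : scaleVec t v ∈ cone V := by
  by_contra hn
  have hv0 : v ≠ 0 := by
    rintro rfl
    apply hn
    have : scaleVec t (0 : σ ⊕ τ → ℂ) = 0 := by ext (i | i) <;> simp [scaleVec]
    rw [this]
    exact zero_mem_cone
  -- `F` does not vanish at these rows, but it vanishes at the rescaled rows, which pass through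
  -- `v`.
  obtain ⟨ξ, hξ, hmiss⟩ := exists_dotProduct_eq_zero_of_notMem_cone hF.hasDim hn
  have h1 : rowEval ξ F ≠ 0 := by
    rw [Ne, hF.rowEval_eq_zero_iff]
    rintro ⟨u, hu, hu0, hu'⟩
    obtain ⟨i, hi⟩ := hmiss u hu hu0
    exact hi (hu' i)
  have h2 := congrArg (rowEval ξ) (h t ht)
  rw [rowEval_scaleForm, smul_eq_C_mul, map_mul, (hF.rowEval_eq_zero_iff _).mpr
    ⟨v, hv, hv0, fun i => by rw [dotProduct_scaleVec]; exact hξ i⟩] at h2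
  have h3 : rowEval ξ (C (t ^ N)) = t ^ N := by simp [rowEval]
  rw [h3] at h2
  exact mul_ne_zero (pow_ne_zero N ht) h1 h2.symm

/-- A variety which is stable under the projection onto the second coordinates and not contained in
its center is the join with its intersection, if that intersection is proper. -/
theorem eq_join_of_meetsProperly (hV : IsIrredVariety V) (hY : IsProjClosed Y)
    (hVY : V ⊆ join (Set.univ : Set (PSpace σ)) Y)
    (hproper : MeetsProperly V (embR σ τ '' Y) (join (Set.univ : Set (PSpace σ)) Y))
    (hproj : ∀ v ∈ cone V, scaleVec 0 v ∈ cone V)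
    (hcenter : ∃ v ∈ cone V, v ∘ Sum.inr ≠ 0) :
    V = join (Set.univ : Set (PSpace σ)) (Y ∩ embR σ τ ⁻¹' V) := by
  set W := Y ∩ embR σ τ ⁻¹' V with hW
  have hVW : ∀ v ∈ cone V, v ∘ Sum.inr ∈ cone W := by
    intro v hv
    rw [hW, mem_cone_inter_embR_preimage, ← scaleVec_zero]
    exact ⟨mem_cone_join_univ.mp (cone_subset_cone.mpr hVY hv), hproj v hv⟩
  have hsub : V ⊆ join (Set.univ : Set (PSpace σ)) W :=
    cone_subset_cone.mp fun v hv => mem_cone_join_univ.mpr (hVW v hv)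
  have hprime : (vanishingIdeal ℂ (cone W)).IsPrime := by
    have := hV.isPrime_vanishingIdeal
    -- The projection maps `cone V` onto `cone W`, with `y ↦ (0, y)` as a section, so primality is
    -- inherited by pullback.
    have heq : vanishingIdeal ℂ (cone W) =
        (vanishingIdeal ℂ (cone V)).comap (rename (Sum.inr : τ → σ ⊕ τ)) := by
      ext f
      rw [Ideal.mem_comap]
      constructor
      · intro h v hv
        have h1 : eval (v ∘ Sum.inr) f = 0 := h _ (hVW v hv)
        change eval v _ = 0
        rwa [eval_rename]
      · intro h w hw
        have h1 : eval (Sum.elim 0 w) (rename Sum.inr f) = 0 := h _ (mem_cone_inter_embR_preimage.mp hw).2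
        rwa [eval_rename, Sum.elim_comp_inr] at h1
    rw [heq]
    exact Ideal.IsPrime.comap _
  have hirr : IsIrredVariety (V ∩ embR σ τ '' Y) := by
    have hmem : ∀ v ∈ cone V, scaleVec 0 v ∈ cone (V ∩ embR σ τ '' Y) := by
      intro v hv
      rw [← embR_image_inter_preimage, mem_cone_embR_image]
      exact ⟨by simp [scaleVec_zero], by simpa [scaleVec_zero] using hVW v hv⟩
    refine ⟨isProjClosed_inter_embR_image hV.isClosed hY, ?_, ?_⟩
    · obtain ⟨v, hv, hv0⟩ := hcenter
      have h0 : scaleVec 0 v ≠ 0 := by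
        intro h
        rw [scaleVec_zero] at h
        exact hv0 (funext fun j => congrFun h (Sum.inr j))
      exact ⟨_, hmem v hv h0⟩
    · intro A B hA hB hAB
      -- Irreducibility passes from `V` to `V ∩ X` by pulling closed sets back along the projection,
      -- which fixes `V ∩ X`.
      have key : ∀ A : Set (PSpace (σ ⊕ τ)), V ⊆ {p | scaleVec 0 p.rep ∈ cone A} →
          V ∩ embR σ τ '' Y ⊆ A := by
        intro A h p hp
        have h1 := h hp.1
        have h2 := (mem_cone_embR_image.mp (rep_mem_cone_iff.mpr hp.2)).1
        rw [← rep_mem_cone_iff]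
        have h3 : scaleVec 0 p.rep = p.rep := by
          rw [scaleVec_zero, ← h2, Sum.elim_comp_inl_inr]
        exact h3 ▸ h1
      refine (hV.irred _ _ (isProjClosed_setOf_scaleVec_zero hA)
        (isProjClosed_setOf_scaleVec_zero hB) ?_).imp (key A) (key B)
      intro p hp
      have h1 := cone_subset_cone.mpr hAB (hmem _ (rep_mem_cone_iff.mpr hp))
      -- Points of the center project to zero, which lies in every cone, so either alternative holds
      -- for them.
      by_cases h0 : scaleVec 0 p.rep = 0
      · left
        change scaleVec 0 p.rep ∈ cone A
        rw [h0]
        exact zero_mem_cone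
      · exact (h1 h0).imp (mk_mem_iff h0).mp (mk_mem_iff h0).mp
  -- Being irreducible, `V ∩ X` is its own component, and properness gives `dim V = dim (ℙ^r # W)`;
  -- a strict inclusion would lower the dimension.
  have hdim := hproper _ ⟨⟨hirr, subset_rfl⟩, fun Z hZ _ => hZ.2⟩
  rw [← embR_image_inter_preimage, coneDim_embR_image, coneDim_embR_image, coneDim_join_univ,
    ← hW] at hdim
  by_contra hne
  have hlt := coneDim_add_one_le hV.isClosed hsub hne (isPrime_vanishingIdeal_join hprime)
  rw [coneDim_join_univ] at hlt
  obtain ⟨a, ha⟩ := exists_coneDim_eq_natCast V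
  obtain ⟨b, hb⟩ := exists_coneDim_eq_natCast W
  obtain ⟨c, hc⟩ := exists_coneDim_eq_natCast Y
  rw [ha, hb, hc] at hdim
  rw [ha, hb] at hlt
  have h1 : b + (c + Nat.card σ) = a + c := by exact_mod_cast hdim
  have h2 : a + 1 ≤ b + Nat.card σ := by exact_mod_cast hlt
  omega

/-- A variety contained in the center of the projection whose Chow form has maximal weight is the
whole center. -/
theorem IsChowForm.mem_cone_of_center [Nontrivial (σ ⊕ τ)] (hF : IsChowForm V F)
    (h : ∀ t : ℂ, t ≠ 0 → scaleForm t F = t ^ (Fintype.card σ * degree V) • F)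
    (hcenter : ∀ v ∈ cone V, v ∘ Sum.inr = 0) {v : σ ⊕ τ → ℂ} (hv : v ∘ Sum.inr = 0) :
    v ∈ cone V := by
  classical
  -- Inside the center only the first coordinates of the rows matter. On rows with zero second part,
  -- scaling by `t` multiplies all `D + 1` rows, and `t = 2` suffices to compare exponents.
  have hcard : Fintype.card (Fin (D + 1)) = Fintype.card σ := by
    obtain ⟨η, hη⟩ := exists_rowEval_ne_zero hF.irreducible.ne_zero
    let ξ : Fin (D + 1) → σ ⊕ τ → ℂ := fun k => Sum.elim (η k ∘ Sum.inl) 0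
    have hξ : rowEval ξ F ≠ 0 := by
      rw [Ne, hF.rowEval_eq_zero_iff] at hη ⊢
      rintro ⟨u, hu, hu0, h1⟩
      refine hη ⟨u, hu, hu0, fun k => ?_⟩
      have := h1 k
      rw [dotProduct_sum, hcenter u hu, dotProduct_zero, add_zero] at this ⊢
      simpa [ξ] using this
    have h1 := congrArg (rowEval ξ) (h 2 two_ne_zero)
    have h2 := hF.rowEval_smul_rows 2 ξ Finset.univ
    have h3 : (fun i => scaleVec 2 (ξ i)) = fun k => if k ∈ Finset.univ then (2 : ℂ) • ξ k else ξ k := by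
      ext k (j | j) <;> simp [ξ, scaleVec]
    have h4 : rowEval ξ (C ((2 : ℂ) ^ (Fintype.card σ * degree V))) =
        2 ^ (Fintype.card σ * degree V) := by simp [rowEval]
    rw [rowEval_scaleForm, h3, h2, smul_eq_C_mul, map_mul, h4] at h1
    have h5 := mul_right_cancel₀ hξ h1
    have h6 : (2 : ℕ) ^ (Finset.univ.card (α := Fin (D + 1)) * degree V) =
        2 ^ (Fintype.card σ * degree V) := by exact_mod_cast h5
    exact Nat.eq_of_mul_eq_mul_right (Nat.pos_of_ne_zero hF.degree_ne_zero)
      (Nat.pow_right_injective le_rfl h6)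
  let e : Fin (D + 1) ≃ σ := Fintype.equivOfCardEq hcard
  by_cases hv0 : v = 0
  · rw [hv0]
    exact zero_mem_cone
  obtain ⟨j, hj⟩ : ∃ j, v (Sum.inl j) ≠ 0 := by
    by_contra! hn
    apply hv0
    ext (i | i)
    · exact hn i
    · exact congrFun hv i
  -- These `D` rows cut out only the point `[v]` in the center, and `D` hyperplanes always meet `V`.
  obtain ⟨u, hu, hu0, h1⟩ := hF.exists_mem_cone hF.degree_ne_zero
    (hF.isWeightedHomogeneous (e.symm j)) fun k =>
      v (Sum.inl j) • Pi.single (Sum.inl (e k)) 1 - v (Sum.inl (e k)) • Pi.single (Sum.inl j) 1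
  have h2 : ∀ i, v (Sum.inl j) * u (Sum.inl i) = v (Sum.inl i) * u (Sum.inl j) := by
    intro i
    by_cases hi : i = j
    · rw [hi]
    · have := h1 (e.symm i) (by simpa using hi)
      simp [sub_dotProduct] at this
      linear_combination this
  have huv : u = (u (Sum.inl j) / v (Sum.inl j)) • v := by
    ext (i | i)
    · rw [Pi.smul_apply, smul_eq_mul]
      field_simp
      linear_combination h2 i
    · have h3 : u (Sum.inr i) = 0 := congrFun (hcenter u hu) i
      have h4 : v (Sum.inr i) = 0 := congrFun hv i
      rw [Pi.smul_apply, h3, h4, smul_zero]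
  have hc : u (Sum.inl j) / v (Sum.inl j) ≠ 0 := by
    intro hc
    rw [hc, zero_smul] at huv
    exact hu0 huv
  have h5 := smul_mem_cone (huv ▸ hu) (u (Sum.inl j) / v (Sum.inl j))⁻¹
  rwa [smul_smul, inv_mul_cancel₀ hc, one_smul] at h5

end Backward

end ChowJoin

end

theorem mainTheorem4 (r n D d : ℕ)
    (X : Set (ChowJoin.PSpace (Fin (n + 1)))) (hX : ChowJoin.IsIrredVariety X)
    (V : Set (ChowJoin.PSpace (Fin (r + 1) ⊕ Fin (n + 1)))) (hV : ChowJoin.IsIrredVariety V)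
    (hVX : V ⊆ ChowJoin.join (Set.univ : Set (ChowJoin.PSpace (Fin (r + 1)))) X)
    (hd : ChowJoin.degree V = d)
    (hproper : ChowJoin.MeetsProperly V (ChowJoin.embR (Fin (r + 1)) (Fin (n + 1)) '' X)
      (ChowJoin.join (Set.univ : Set (ChowJoin.PSpace (Fin (r + 1)))) X))
    (F : MvPolynomial (Fin (D + 1) × (Fin (r + 1) ⊕ Fin (n + 1))) ℂ)
    (hF : ChowJoin.IsChowForm V F) :
    V = ChowJoin.join (Set.univ : Set (ChowJoin.PSpace (Fin (r + 1))))
        (X ∩ ChowJoin.embR (Fin (r + 1)) (Fin (n + 1)) ⁻¹' V) ↔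
      ∀ t : ℂ, t ≠ 0 → ChowJoin.scaleForm t F = t ^ ((r + 1) * d) • F := by
  have : Nontrivial (Fin (r + 1) ⊕ Fin (n + 1)) := ⟨Sum.inl 0, Sum.inr 0, Sum.inl_ne_inr⟩
  have hcard : (r + 1) * d = Fintype.card (Fin (r + 1)) * ChowJoin.degree V := by
    rw [hd, Fintype.card_fin]
  rw [hcard]
  constructor
  · intro h t ht
    exact hF.scaleForm_eq_of_join h ht
  · intro h
    by_cases hcenter : ∃ v ∈ ChowJoin.cone V, v ∘ Sum.inr ≠ 0
    · exact ChowJoin.eq_join_of_meetsProperly hV hX.isClosed hVX hproper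
        (fun v hv => ChowJoin.scaleVec_zero_mem_cone hV.isClosed fun t ht =>
          hF.scaleVec_mem_cone h hv ht) hcenter
    · push Not at hcenter
      apply ChowJoin.cone_injective
      ext v
      rw [ChowJoin.mem_cone_join_univ, ChowJoin.mem_cone_inter_embR_preimage]
      constructor
      · intro hv
        have h0 : Sum.elim (0 : Fin (r + 1) → ℂ) (0 : Fin (n + 1) → ℂ) = 0 := by
          ext (i | i) <;> rfl
        rw [hcenter v hv, h0]
        exact ⟨ChowJoin.zero_mem_cone, ChowJoin.zero_mem_cone⟩
      · intro hv
        exact hF.mem_cone_of_center h hcenter (by simpa using hcenter _ hv.2)
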